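/- Let $\mathbb{F}_q$ be a finite field, and write $\mathcal{I}_q^n$ for the set of monic irreducible polynomials of degree $n$ in $\mathbb{F}_q[x]$ and $\mathcal{I}_q=\bigcup_{n}\mathcal{I}_q^n$. For $A=\begin{pmatrix}a&b\\c&d\end{pmatrix}\in\mathrm{GL}_2(\mathbb{F}_q)$ with class $[A]\in\mathrm{PGL}_2(\mathbb{F}_q)$ write $[A]\circ x=\frac{ax+b}{cx+d}$. Let $G\le \mathrm{PGL}_2(\mathbb{F}_q)$ be a cyclic subgroup of prime order $s$. Let $Q_G\in\mathbb{F}_q(x)$ be a quotient map for $G$, that is, $Q_G=g/h$ with $g,h\in\mathbb{F}_q[x]$ coprime, $g$ monic, $\deg h<\deg g=|G|$, and $\mathbb{F}_q(Q_G)=\{R\in\mathbb{F}_q(x) : R([A]\circ x)=R(x)\text{ for all }[A]\in G\}$. For $f\in\mathbb{F}_q[x]$, $f\ne 0$, put $f^{Q_G}(x)=h(x)^{\deg f}\,f\!\left(\frac{g(x)}{h(x)}\right)$, and for $n\ge 1$ define $$C(Q_G,n)=\{f\in\mathcal{I}_q^n : f^{Q_G}\in\mathcal{I}_q^{|G|n}\},\qquad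 D(Q_G,n)=\mathcal{I}_q^n\setminus C(Q_G,n).$$ For $f\in\mathbb{F}_q[x]$, $f\neq 0$, let $[A]\ast f$ be the monic scalar multiple of $(cx+d)^{\deg f}f\!\left(\frac{ax+b}{cx+d}\right)$. Let $\mathcal{I}_q^G$ be the set of $r\in\mathcal{I}_q$ that have no root in the $G$-orbit of $\infty$ (for the action of $G$ on $\mathbb{F}_q\cup\{\infty\}$ by $[A]\circ v=\frac{av+b}{cv+d}$); for $r\in\mathcal{I}_q^G$ let $G\ast r=\{[A]\ast r : [A]\in G\}$ and let $\prod G\ast r$ be the product of the distinct elements of $G\ast r$. Let $d(G)$ be the largest degree of a polynomial $F\in\mathcal{I}_q$ such that $F^{Q_G}=\left(\prod G\ast r\right)^k$ for some $r\in\mathcal{I}_q^G$ and some integer $k>1$, and $d(G)=0$ if there is no such $F$ (this number does not depend on the choice of the quotient map $Q_G$). Then for all $n>d(G)$ $$|C(Q_G,n)|-(s-1)\,|D(Q_G,n)|=\begin{cases}0,&\text{if } s\nmid n,\\ |C(Q_G,n/s)|,&\text{if } s\mid n.\end{cases}$$ -/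

import Mathlib

open Polynomial
open scoped MatrixGroups

namespace RationalTransform

noncomputable section

variable {F : Type*} [Field F]

/-- The linear rational function `[A] ∘ x = (a x + b) / (c x + d)` in `F(x)`. -/
def mobius (A : GL (Fin 2) F) : RatFunc F :=
  (RatFunc.C (A 0 0) * RatFunc.X + RatFunc.C (A 0 1)) /
    (RatFunc.C (A 1 0) * RatFunc.X + RatFunc.C (A 1 1))

/-- The set `F(x)^G` of `G`-invariant rational functions: all `R` with `R([A] ∘ x) = R(x)` for
every `[A] ∈ G`. (The function `[A] ∘ x` is not constant, so the denominator of `R` does not vanish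
at it and the substitution is the genuine one.) -/
def invariantFunctions (G : Subgroup PGL(2, F)) : Set (RatFunc F) :=
  {R | ∀ A : GL (Fin 2) F, Matrix.ProjGenLinGroup.mk A ∈ G →
    RatFunc.eval (RatFunc.C : F →+* RatFunc F) (mobius A) R = R}

/-- The numerator `g` of `Q = g / h` in lowest terms, scaled to be monic (if `Q ≠ 0`). -/
def monicNum (Q : RatFunc F) : F[X] := C (Q.num.leadingCoeff)⁻¹ * Q.num

/-- The denominator `h` of `Q = g / h` in lowest terms, where `g` is scaled to be monic. -/
def denomOfMonicNum (Q : RatFunc F) : F[X] := C (Q.num.leadingCoeff)⁻¹ * Q.denom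

/-- `Q = g / h` is a quotient map for `G`: it generates the field `F(x)^G` over `F`, and
`deg h < deg g = |G|`. -/
structure IsQuotientMap (G : Subgroup PGL(2, F)) (Q : RatFunc F) : Prop where
  adjoin_eq : (IntermediateField.adjoin F {Q} : Set (RatFunc F)) = invariantFunctions G
  natDegree_num : (monicNum Q).natDegree = Nat.card G
  natDegree_denom_lt : (denomOfMonicNum Q).natDegree < (monicNum Q).natDegree

/-- The homogenised substitution `h ^ deg f * f (g / h)`. -/
def transform (g h f : F[X]) : F[X] :=
  ∑ i ∈ Finset.range (f.natDegree + 1), C (f.coeff i) * g ^ i * h ^ (f.natDegree - i)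

/-- The `Q`-transform `f ^ Q` of `f`, for `Q = g / h` in lowest terms with `g` monic. -/
def ratTransform (Q : RatFunc F) (f : F[X]) : F[X] :=
  transform (monicNum Q) (denomOfMonicNum Q) f

/-- `[A] ∗ f`: the polynomial `(c x + d) ^ deg f * f ((a x + b) / (c x + d))`, scaled to be
monic. -/
def mobiusAct (A : GL (Fin 2) F) (f : F[X]) : F[X] :=
  let p := transform (C (A 0 0) * X + C (A 0 1)) (C (A 1 0) * X + C (A 1 1)) f
  C p.leadingCoeff⁻¹ * p

variable (F) in
/-- The monic irreducible polynomials of degree `n`. -/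
def monicIrred (n : ℕ) : Set F[X] :=
  {f | f.Monic ∧ Irreducible f ∧ f.natDegree = n}

/-- The finite points of the `G`-orbit of `∞`: the values `[A] ∘ ∞ = a / c` with `c ≠ 0`. -/
def finiteOrbitInfty (G : Subgroup PGL(2, F)) : Set F :=
  {α | ∃ A : GL (Fin 2) F, Matrix.ProjGenLinGroup.mk A ∈ G ∧ A 1 0 ≠ 0 ∧ α = A 0 0 / A 1 0}

/-- The monic irreducible polynomials without a root in the `G`-orbit of `∞`. -/
def monicIrredNR (G : Subgroup PGL(2, F)) : Set F[X] :=
  {r | r.Monic ∧ Irreducible r ∧ ∀ α ∈ finiteOrbitInfty G, r.eval α ≠ 0}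

/-- The `G`-orbit `G ∗ r`. -/
def polyOrbit (G : Subgroup PGL(2, F)) (r : F[X]) : Set F[X] :=
  {t | ∃ A : GL (Fin 2) F, Matrix.ProjGenLinGroup.mk A ∈ G ∧ t = mobiusAct A r}

/-- The product `∏ G ∗ r` of the distinct elements of the orbit of `r`. -/
def orbitPoly (G : Subgroup PGL(2, F)) (r : F[X]) : F[X] :=
  ∏ᶠ t ∈ polyOrbit G r, t

/-- The degrees of the monic irreducible polynomials `f` for which `f ^ Q` is a proper power of a
`G`-orbit polynomial. -/
def exceptionalDegrees (G : Subgroup PGL(2, F)) (Q : RatFunc F) : Set ℕ :=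
  {m | ∃ f ∈ monicIrred F m, ∃ r ∈ monicIrredNR G, ∃ k : ℕ, 1 < k ∧
    ratTransform Q f = orbitPoly G r ^ k}

/-- The largest exceptional degree; it is `0` if there is none. -/
def exceptionalBound (G : Subgroup PGL(2, F)) (Q : RatFunc F) : ℕ :=
  sSup (exceptionalDegrees G Q)

/-- `C(Q, n)`: the monic irreducible `f` of degree `n` such that `f ^ Q` is (monic) irreducible of
degree `|G| n`. -/
def setC (G : Subgroup PGL(2, F)) (Q : RatFunc F) (n : ℕ) : Set F[X] :=
  {f ∈ monicIrred F n | ratTransform Q f ∈ monicIrred F (Nat.card G * n)}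

/-- `D(Q, n)`: the complement of `C(Q, n)` among the monic irreducibles of degree `n`. -/
def setD (G : Subgroup PGL(2, F)) (Q : RatFunc F) (n : ℕ) : Set F[X] :=
  monicIrred F n \ setC G Q n

end

end RationalTransform

/-!
Let `K` be an algebraic closure of `F`, `q = |F|`, and let `A` be a matrix whose class generates
`G`. The quotient map `Q = g / h` induces a map `ratMap` of the projective line over `K`. It is
invariant under the Möbius transformation `mob K A`, since invariance of `Q` makes the binary
forms of degree `s` attached to `g` and `h` semi-invariant with a common factor
(`IsQuotientMap.isInvariantFraction`). All its fibres have at most `s` points, so a fibre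
containing a point moved by `A` is exactly the `G`-orbit of that point, with `s` elements
(`IsPrimeQuotient.fiber_eq_orbit`).

Let `f` be monic irreducible of degree `m`, and `x` a point above a root of `f`. The degree of `x`
over `F` is its Frobenius period, so the transform of `f` is irreducible exactly when `Frob ^ m`
moves `x` (`IsPrimeQuotient.transform_mem_monicIrred_iff`). Hence `C(Q, m)` and `D(Q, m)` count,
up to the factor `s * m`, the points `x` whose image has period `m` and which `Frob ^ m` moves or
fixes, respectively. Comparing them is a question about the dynamics of Frobenius and `A` only,
settled by `ncard_inertPoints`: for `n > 0` and every power of `A`, the equation `Frob ^ n (x) = A ^ i (x)`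
has the same number `q ^ n + 1` of solutions on the projective line (`ncard_iterate_frob_eq_mob`),
fixed points of `A` contribute equally for all `i`, and comparing `i = 0` with the sum over all
`i`, then inverting over the divisors of `n`, gives the relation between moved and unmoved points.

It remains to see that the points discarded, namely those fixed by `A` and those above `∞`, do not
matter for `n` above the exceptional bound. Distinct fixed points of `A` lie in distinct fibres
(`IsPrimeQuotient.eq_of_ratMap_eq_of_fixed`). Therefore, if the fibre over a root of `f` contains
a fixed point `x`, the transform of `f` is a proper power of the minimal polynomial of `x`, and
`deg f` is an exceptional degree (`IsPrimeQuotient.transform_eq_orbitPoly_pow`). Exceptional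
degrees are bounded because `A` has finitely many fixed points. Points above `∞` moved by `A` are
rational, so they could matter only for `n = 1`; but if they exist, `A` has a finite fixed point
with finite image, and the exceptional bound is at least `1`.
-/

/-! ### Counting twisted periodic points -/

namespace RationalTransform

open Function

/-- Counting the elements of a finite set fibre by fibre. -/
theorem ncard_eq_sum_ncard_fiber {α β : Type*} {X : Set α} (hX : X.Finite) (f : α → β)
    (t : Finset β) (hf : ∀ x ∈ X, f x ∈ t) :
    X.ncard = ∑ b ∈ t, {x ∈ X | f x = b}.ncard := by
  classical
  rw [Set.ncard_eq_toFinset_card X hX, Finset.card_eq_sum_card_fiberwise (f := f) (t := t)]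
  · refine Finset.sum_congr rfl fun b _ => ?_
    rw [← Set.ncard_coe_finset]
    congr 1
    ext x
    simp
  · intro x hx
    exact hf x (by simpa using hx)

section Dynamics

variable {P Y : Type*} {φ a : P → P} {ψ : Y → Y} {π : P → Y} {s : ℕ}

theorem iterate_eq_self_iff_dvd (hs : s.Prime) (ha : ∀ p, a^[s] p = p) {p : P} (hp : a p ≠ p)
    (i : ℕ) : a^[i] p = p ↔ s ∣ i := by
  have := Fact.mk hs
  have h : minimalPeriod a p = s := minimalPeriod_eq_prime (ha p) hp
  have := isPeriodicPt_iff_minimalPeriod_dvd (f := a) (x := p) (n := i)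
  rwa [h] at this

theorem iterate_injOn_range (hs : s.Prime) (ha : ∀ p, a^[s] p = p) {p : P} (hp : a p ≠ p)
    {i j : ℕ} (hi : i < s) (hj : j < s) (hij : a^[i] p = a^[j] p) : i = j := by
  have := Fact.mk hs
  have h : minimalPeriod a p = s := minimalPeriod_eq_prime (ha p) hp
  exact (iterate_eq_iterate_iff_of_lt_minimalPeriod (h ▸ hi) (h ▸ hj)).1 hij

theorem iterate_mod_eq (ha : ∀ p, a^[s] p = p) (i : ℕ) (p : P) : a^[i % s] p = a^[i] p :=
  IsPeriodicPt.iterate_mod_apply (ha p) i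

theorem iterate_mul_eq_of_eq (hcomm : Function.Commute φ a) {m j : ℕ} {p : P}
    (h : φ^[m] p = a^[j] p) (k : ℕ) : φ^[m * k] p = a^[j * k] p := by
  induction k with
  | zero => simp
  | succ k ih =>
    rw [Nat.mul_succ, iterate_add_apply, h, (hcomm.iterate_iterate (m * k) j).eq, ih,
      ← iterate_add_apply, Nat.mul_succ, add_comm]

/-- The points `p` moved by `a` whose image has exact period `n` and which `φ ^ n` moves within
the fibre of `π`. -/
def inertPoints (φ a : P → P) (ψ : Y → Y) (π : P → Y) (n : ℕ) : Set P :=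
  {p | a p ≠ p ∧ minimalPeriod ψ (π p) = n ∧ φ^[n] p ≠ p}

/-- The points `p` moved by `a` whose image has exact period `n` and which are fixed by `φ ^ n`. -/
def splitPoints (φ a : P → P) (ψ : Y → Y) (π : P → Y) (n : ℕ) : Set P :=
  {p | a p ≠ p ∧ minimalPeriod ψ (π p) = n ∧ φ^[n] p = p}

/-- If the twisted fixed point counts of `φ ^ n` by powers of `a` do not depend on the twist, then
the inert points outnumber the split points `s - 1` to one, up to a correction coming from the
inert points of period `n / s`. -/
theorem ncard_inertPoints (hs : s.Prime) (hcomm : Function.Commute φ a)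
    (ha : ∀ p, a^[s] p = p) (hπ : Semiconj π φ ψ) (hπa : ∀ p, π (a p) = π p)
    (hfib : ∀ p p', a p ≠ p → π p' = π p → ∃ i, p' = a^[i] p) (N : ℕ → ℕ)
    (hfin : ∀ n, 0 < n → ∀ i, {p | φ^[n] p = a^[i] p}.Finite)
    (hN : ∀ n, 0 < n → ∀ i, {p | φ^[n] p = a^[i] p}.ncard = N n) (n : ℕ) (hn : 0 < n) :
    ((inertPoints φ a ψ π n).ncard : ℤ) = (s - 1) * (splitPoints φ a ψ π n).ncard
      + if s ∣ n then (s : ℤ) * (inertPoints φ a ψ π (n / s)).ncard else 0 := by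
  have hπφ : ∀ n p, ψ^[n] (π p) = π (φ^[n] p) := fun n p => ((hπ.iterate_right n).eq p).symm
  have hπai : ∀ i p, π (a^[i] p) = π p := by
    intro i
    induction i with
    | zero => simp
    | succ i ih => intro p; rw [iterate_succ_apply', hπa, ih]
  -- the points moved by `a` whose image is fixed by `ψ ^ n`, and those twisted by `a ^ i`
  let X : ℕ → Set P := fun n => {p | a p ≠ p ∧ ψ^[n] (π p) = π p}
  let U : ℕ → ℕ → Set P := fun n i => {p | a p ≠ p ∧ φ^[n] p = a^[i] p}
  have hexists : ∀ n p, p ∈ X n → ∃ i < s, φ^[n] p = a^[i] p := by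
    rintro n p ⟨hp, hpn⟩
    rw [hπφ] at hpn
    obtain ⟨i, hi⟩ := hfib p _ hp hpn
    exact ⟨i % s, Nat.mod_lt _ hs.pos, by rw [iterate_mod_eq ha, hi]⟩
  have hXfin : ∀ n, 0 < n → (X n).Finite := by
    intro n hn
    refine ((Set.finite_Iio s).biUnion (t := fun i => {p | φ^[n] p = a^[i] p})
      fun i _ => hfin n hn i).subset ?_
    intro p hp
    obtain ⟨i, hi, h⟩ := hexists n p hp
    exact Set.mem_biUnion (show i ∈ Set.Iio s from hi) h
  have hUcard : ∀ n, 0 < n → ∀ i, (U n i).ncard = (U n 0).ncard := by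
    intro n hn i
    have key : ∀ i, (U n i).ncard + {p | a p = p ∧ φ^[n] p = p}.ncard = N n := by
      intro i
      have hdisj : Disjoint (U n i) {p | a p = p ∧ φ^[n] p = p} :=
        Set.disjoint_left.2 fun p h1 h2 => h1.1 h2.1
      rw [← hN n hn i, ← Set.ncard_union_eq hdisj ((hfin n hn i).subset fun p hp => hp.2)
        ((hfin n hn 0).subset fun p hp => hp.2)]
      congr 1
      ext p
      simp only [U, Set.mem_union, Set.mem_ofPred_eq]
      by_cases hp : a p = p
      · simp [hp, iterate_fixed hp i]
      · simp [hp]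
    have h1 := key i
    have h2 := key 0
    lia
  have hXcard : ∀ n, 0 < n → (X n).ncard = s * (U n 0).ncard := by
    intro n hn
    choose! idx hidx using hexists n
    rw [ncard_eq_sum_ncard_fiber (hXfin n hn) idx (Finset.range s)
      fun p hp => Finset.mem_range.2 (hidx p hp).1]
    rw [Finset.sum_congr rfl (g := fun _ => (U n 0).ncard), Finset.sum_const, Finset.card_range,
      smul_eq_mul]
    intro i hi
    rw [Finset.mem_range] at hi
    rw [← hUcard n hn i]
    congr 1
    ext p
    constructor
    · rintro ⟨hp, rfl⟩
      exact ⟨hp.1, (hidx p hp).2⟩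
    · rintro ⟨hp, h⟩
      have hpX : p ∈ X n := ⟨hp, by rw [hπφ, h, hπai]⟩
      exact ⟨hpX, iterate_injOn_range hs ha hp (hidx p hpX).1 hi ((hidx p hpX).2.symm.trans h)⟩
  set c : ℕ → ℕ := fun n => (inertPoints φ a ψ π n).ncard with hc
  set d : ℕ → ℕ := fun n => (splitPoints φ a ψ π n).ncard with hd
  have hsubX : ∀ m, inertPoints φ a ψ π m ⊆ X m ∧ splitPoints φ a ψ π m ⊆ X m := by
    intro m
    constructor <;>
    · rintro p ⟨h1, h2, -⟩
      exact ⟨h1, h2 ▸ isPeriodicPt_minimalPeriod ψ (π p)⟩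
  have hdisj : ∀ m, Disjoint (inertPoints φ a ψ π m) (splitPoints φ a ψ π m) := by
    intro m
    rw [Set.disjoint_left]
    rintro p ⟨-, -, h⟩ ⟨-, -, h'⟩
    exact h h'
  have hXsum : ∀ n, 0 < n → (X n).ncard = ∑ m ∈ n.divisors, (c m + d m) := by
    intro n hn
    rw [ncard_eq_sum_ncard_fiber (hXfin n hn) (fun p => minimalPeriod ψ (π p)) n.divisors]
    · refine Finset.sum_congr rfl fun m hm => ?_
      have hm' := Nat.pos_of_mem_divisors hm
      rw [hc, hd, ← Set.ncard_union_eq (hdisj m) ((hXfin m hm').subset (hsubX m).1)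
        ((hXfin m hm').subset (hsubX m).2)]
      congr 1
      ext p
      simp only [X, inertPoints, splitPoints, Set.mem_union, Set.mem_ofPred_eq]
      constructor
      · rintro ⟨⟨h1, -⟩, h3⟩
        by_cases h : φ^[m] p = p <;> simp [h1, h3, h]
      · intro h
        have h1 : a p ≠ p ∧ minimalPeriod ψ (π p) = m := by tauto
        refine ⟨⟨h1.1, ?_⟩, h1.2⟩
        rw [← IsFixedPt, ← IsPeriodicPt, isPeriodicPt_iff_minimalPeriod_dvd, h1.2]
        exact Nat.dvd_of_mem_divisors hm
    · rintro p ⟨-, hp⟩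
      exact Nat.mem_divisors.2 ⟨IsPeriodicPt.minimalPeriod_dvd hp, hn.ne'⟩
  have hUsum : ∀ n, 0 < n →
      (U n 0).ncard = ∑ m ∈ n.divisors, (d m + if s ∣ n / m then c m else 0) := by
    intro n hn
    have hUX : U n 0 ⊆ X n := by
      rintro p ⟨hp, h⟩
      exact ⟨hp, by rw [hπφ, h]; rfl⟩
    rw [ncard_eq_sum_ncard_fiber ((hXfin n hn).subset hUX) (fun p => minimalPeriod ψ (π p))
      n.divisors]
    · refine Finset.sum_congr rfl fun m hm => ?_
      have hm' := Nat.pos_of_mem_divisors hm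
      obtain ⟨k, rfl⟩ := Nat.dvd_of_mem_divisors hm
      rw [Nat.mul_div_cancel_left k hm']
      have hiff : ∀ p, a p ≠ p → minimalPeriod ψ (π p) = m →
          (φ^[m * k] p = p ↔ (φ^[m] p = p ∨ s ∣ k)) := by
        intro p hp hpm
        obtain ⟨j, -, hj⟩ := hexists m p ⟨hp, hpm ▸ isPeriodicPt_minimalPeriod ψ (π p)⟩
        rw [iterate_mul_eq_of_eq hcomm hj, hj, iterate_eq_self_iff_dvd hs ha hp,
          iterate_eq_self_iff_dvd hs ha hp, hs.dvd_mul]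
      have hper : ∀ p, minimalPeriod ψ (π p) = m → ψ^[m * k] (π p) = π p := by
        intro p hpm
        rw [← IsFixedPt, ← IsPeriodicPt, isPeriodicPt_iff_minimalPeriod_dvd, hpm]
        exact Dvd.intro k rfl
      split_ifs with hk
      · rw [hc, hd, add_comm, ← Set.ncard_union_eq (hdisj m) ((hXfin m hm').subset (hsubX m).1)
          ((hXfin m hm').subset (hsubX m).2)]
        congr 1
        ext p
        simp only [U, inertPoints, splitPoints, Set.mem_union, Set.mem_ofPred_eq, iterate_zero, id]
        constructor
        · rintro ⟨⟨h1, -⟩, h3⟩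
          by_cases h : φ^[m] p = p <;> simp [h1, h3, h]
        · intro h
          have h1 : a p ≠ p ∧ minimalPeriod ψ (π p) = m := by tauto
          exact ⟨⟨h1.1, (hiff p h1.1 h1.2).2 (Or.inr hk)⟩, h1.2⟩
      · rw [hd, add_zero]
        congr 1
        ext p
        simp only [U, splitPoints, Set.mem_ofPred_eq, iterate_zero, id]
        constructor
        · rintro ⟨⟨h1, h2⟩, h3⟩
          exact ⟨h1, h3, ((hiff p h1 h3).1 h2).resolve_right hk⟩
        · rintro ⟨h1, h2, h3⟩
          exact ⟨⟨h1, (hiff p h1 h2).2 (Or.inl h3)⟩, h2⟩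
    · rintro p hp
      exact Nat.mem_divisors.2 ⟨IsPeriodicPt.minimalPeriod_dvd (hUX hp).2, hn.ne'⟩
  -- reindex the inert contribution by `m ↦ s * m`
  have hreindex : ∀ n, 0 < n → ∑ m ∈ n.divisors, (if s ∣ n / m then c m else 0)
      = ∑ m ∈ n.divisors, if s ∣ m then c (m / s) else 0 := by
    intro n hn
    rw [← Finset.sum_filter, ← Finset.sum_filter]
    refine Finset.sum_bij' (fun m _ => s * m) (fun m _ => m / s) ?_ ?_ ?_ ?_ ?_
    · intro m hm
      simp only [Finset.mem_filter, Nat.mem_divisors] at hm ⊢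
      obtain ⟨⟨⟨k, rfl⟩, h0⟩, hk⟩ := hm
      have hm0 : 0 < m := Nat.pos_of_ne_zero (by rintro rfl; simp at h0)
      rw [Nat.mul_div_cancel_left k hm0] at hk
      exact ⟨⟨by rw [mul_comm s m]; exact Nat.mul_dvd_mul_left m hk, h0⟩, Dvd.intro _ rfl⟩
    · intro m hm
      simp only [Finset.mem_filter, Nat.mem_divisors] at hm ⊢
      obtain ⟨⟨⟨k, rfl⟩, h0⟩, ⟨l, rfl⟩⟩ := hm
      have hl : 0 < l := Nat.pos_of_ne_zero (by rintro rfl; simp at h0)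
      rw [Nat.mul_div_cancel_left l hs.pos]
      refine ⟨⟨⟨s * k, by ring⟩, h0⟩, ?_⟩
      rw [show s * l * k = l * (s * k) by ring, Nat.mul_div_cancel_left _ hl]
      exact Dvd.intro _ rfl
    · intro m _
      exact Nat.mul_div_cancel_left m hs.pos
    · intro m hm
      simp only [Finset.mem_filter] at hm
      exact Nat.mul_div_cancel' hm.2
    · intro m _
      rw [Nat.mul_div_cancel_left m hs.pos]
  -- the defect of the claimed identity sums to zero over the divisors of every `n`
  let e : ℕ → ℤ := fun n => (c n : ℤ) - (s - 1) * d n - if s ∣ n then (s : ℤ) * c (n / s) else 0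
  have hesum : ∀ n, 0 < n → ∑ m ∈ n.divisors, e m = 0 := by
    intro n hn
    have h := (hXsum n hn).symm.trans (hXcard n hn)
    rw [hUsum n hn, Finset.sum_add_distrib, Finset.sum_add_distrib, hreindex n hn] at h
    have h' : (∑ m ∈ n.divisors, (c m : ℤ)) + ∑ m ∈ n.divisors, (d m : ℤ)
        = s * (∑ m ∈ n.divisors, (d m : ℤ)
          + ∑ m ∈ n.divisors, if s ∣ m then (c (m / s) : ℤ) else 0) := by
      exact_mod_cast h
    have h2 : ∑ m ∈ n.divisors, (if s ∣ m then (s : ℤ) * c (m / s) else 0)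
        = s * ∑ m ∈ n.divisors, if s ∣ m then (c (m / s) : ℤ) else 0 := by
      rw [Finset.mul_sum]
      exact Finset.sum_congr rfl fun m _ => by split_ifs <;> simp
    simp only [e]
    rw [Finset.sum_sub_distrib, Finset.sum_sub_distrib, h2, ← Finset.mul_sum]
    linear_combination h'
  have he : ∀ n, 0 < n → e n = 0 := by
    intro n
    induction n using Nat.strong_induction_on with
    | _ n ih =>
      intro hn
      have h := hesum n hn
      rw [← Nat.cons_self_properDivisors hn.ne', Finset.sum_cons,
        Finset.sum_eq_zero (s := n.properDivisors), add_zero] at h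
      · exact h
      · intro m hm
        exact ih m (Nat.mem_properDivisors.1 hm).2 (Nat.pos_of_mem_properDivisors hm)
  have := he n hn
  simp only [e, hc, hd] at this
  linarith

end Dynamics

end RationalTransform

/-! ### Binary forms and the semi-invariance of the quotient map -/

namespace RationalTransform

open Polynomial
open scoped MatrixGroups

noncomputable section

variable {F : Type*} [Field F]

/-- The value at `(u, v)` of the binary form of degree `n` obtained by homogenising `p`; it is
meaningful when `natDegree p ≤ n`, as higher coefficients are ignored. -/
def homEval {R : Type*} [CommRing R] [Algebra F R] (n : ℕ) (p : F[X]) (u v : R) : R :=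
  ∑ i ∈ Finset.range (n + 1), algebraMap F R (p.coeff i) * u ^ i * v ^ (n - i)

theorem transform_eq_homEval (g h f : F[X]) : transform g h f = homEval f.natDegree f g h := rfl

theorem map_homEval {R S : Type*} [CommRing R] [Algebra F R] [CommRing S] [Algebra F S]
    (σ : R →ₐ[F] S) (n : ℕ) (p : F[X]) (u v : R) :
    σ (homEval n p u v) = homEval n p (σ u) (σ v) := by
  simp [homEval, map_sum]

theorem homEval_C_mul {R : Type*} [CommRing R] [Algebra F R] (n : ℕ) (c : F) (p : F[X])
    (u v : R) : homEval n (C c * p) u v = algebraMap F R c * homEval n p u v := by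
  simp [homEval, Finset.mul_sum, mul_assoc]

theorem homEval_eq_pow_mul_aeval {K : Type*} [Field K] [Algebra F K] {n : ℕ} {p : F[X]}
    (hp : p.natDegree ≤ n) (u : K) {v : K} (hv : v ≠ 0) :
    homEval n p u v = v ^ n * aeval (u / v) p := by
  rw [aeval_eq_sum_range' (Nat.lt_succ_of_le hp), homEval, Finset.mul_sum]
  refine Finset.sum_congr rfl fun i hi => ?_
  have hi' : i ≤ n := Nat.lt_succ_iff.1 (Finset.mem_range.1 hi)
  rw [Algebra.smul_def, div_pow]
  obtain ⟨k, rfl⟩ := Nat.exists_eq_add_of_le hi'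
  rw [Nat.add_sub_cancel_left, pow_add]
  field_simp

theorem homEval_zero_right {R : Type*} [CommRing R] [Algebra F R] (n : ℕ) (p : F[X]) (u : R) :
    homEval n p u 0 = algebraMap F R (p.coeff n) * u ^ n := by
  rw [homEval, Finset.sum_eq_single n]
  · simp
  · intro i hi hin
    have : n - i ≠ 0 := by
      have := Finset.mem_range.1 hi
      lia
    simp [this]
  · simp

/-- The numerator `a x + b` of `[A] ∘ x`. -/
def linNum (A : GL (Fin 2) F) : F[X] := C (A 0 0) * X + C (A 0 1)

/-- The denominator `c x + d` of `[A] ∘ x`. -/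
def linDen (A : GL (Fin 2) F) : F[X] := C (A 1 0) * X + C (A 1 1)

theorem natDegree_homEval_le (A : GL (Fin 2) F) (n : ℕ) (p : F[X]) :
    (homEval n p (linNum A) (linDen A)).natDegree ≤ n := by
  refine natDegree_sum_le_of_forall_le _ _ fun i hi => ?_
  have hi' : i ≤ n := Nat.lt_succ_iff.1 (Finset.mem_range.1 hi)
  have h1 : (linNum A ^ i).natDegree ≤ i * 1 := natDegree_pow_le_of_le i natDegree_linear_le
  have h2 : (linDen A ^ (n - i)).natDegree ≤ (n - i) * 1 :=
    natDegree_pow_le_of_le _ natDegree_linear_le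
  rw [algebraMap_eq, mul_assoc]
  refine (natDegree_C_mul_le _ _).trans (natDegree_mul_le.trans ?_)
  lia

theorem det_ne_zero' (A : GL (Fin 2) F) : A 0 0 * A 1 1 - A 0 1 * A 1 0 ≠ 0 := by
  have := A.det_ne_zero
  rwa [Matrix.det_fin_two] at this

theorem linDen_ne_zero (A : GL (Fin 2) F) : linDen A ≠ 0 := by
  intro h
  have h0 : A 1 1 = 0 := by simpa [linDen] using congrArg (fun p => coeff p 0) h
  have h1 : A 1 0 = 0 := by simpa [linDen] using congrArg (fun p => coeff p 1) h
  exact det_ne_zero' A (by rw [h0, h1]; ring)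

/-- A reduced fraction `g / h` of degree `s`, with a pole at `∞`, which is invariant under `G`; the
invariance is expressed by the semi-invariance of the two binary forms of degree `s` given by `g`
and `h`, with a common factor. -/
structure IsInvariantFraction (G : Subgroup PGL(2, F)) (s : ℕ) (g h : F[X]) : Prop where
  isCoprime : IsCoprime g h
  monic : g.Monic
  natDegree_num : g.natDegree = s
  natDegree_denom_lt : h.natDegree < s
  exists_factor : ∀ A : GL (Fin 2) F, Matrix.ProjGenLinGroup.mk A ∈ G → ∃ c : F, c ≠ 0 ∧
    homEval s g (linNum A) (linDen A) = C c * g ∧ homEval s h (linNum A) (linDen A) = C c * h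

theorem IsQuotientMap.isInvariantFraction {G : Subgroup PGL(2, F)} {Q : RatFunc F}
    (hQ : IsQuotientMap G Q) (hG : 0 < Nat.card G) :
    IsInvariantFraction G (Nat.card G) (monicNum Q) (denomOfMonicNum Q) := by
  have hdeg := hQ.natDegree_num
  have hN : Q.num ≠ 0 := by
    intro h
    rw [monicNum, h, mul_zero, natDegree_zero] at hdeg
    exact hG.ne hdeg
  have hQ0 : Q ≠ 0 := fun h => hN (by rw [h, RatFunc.num_zero])
  have hl : (Q.num.leadingCoeff)⁻¹ ≠ 0 := inv_ne_zero (leadingCoeff_ne_zero.2 hN)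
  have hNdeg : Q.num.natDegree = Nat.card G := by
    rw [← hdeg, monicNum, natDegree_C_mul hl]
  have hDdeg : Q.denom.natDegree < Nat.card G := by
    have := hQ.natDegree_denom_lt
    rwa [hdeg, denomOfMonicNum, natDegree_C_mul hl] at this
  refine ⟨?_, ?_, hdeg, hdeg ▸ hQ.natDegree_denom_lt, ?_⟩
  · have hu : IsUnit (C (Q.num.leadingCoeff)⁻¹) := isUnit_C.2 hl.isUnit
    exact (isCoprime_mul_unit_left hu _ _).2 (RatFunc.isCoprime_num_denom Q)
  · rw [monicNum, mul_comm]
    exact monic_mul_leadingCoeff_inv hN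
  intro A hA
  have hmem : Q ∈ invariantFunctions G := by
    rw [← hQ.adjoin_eq]
    exact IntermediateField.mem_adjoin_simple_self F Q
  have hinv := hmem A hA
  set s := Nat.card G
  let ι : F[X] →ₐ[F] RatFunc F := IsScalarTower.toAlgHom F F[X] (RatFunc F)
  have hι : ∀ p, ι p = algebraMap F[X] (RatFunc F) p := fun _ => rfl
  have hιinj : Function.Injective ι := IsFractionRing.injective F[X] (RatFunc F)
  have hw : ι (linDen A) ≠ 0 := (map_ne_zero_iff ι hιinj).2 (linDen_ne_zero A)
  have hmob : mobius A = ι (linNum A) / ι (linDen A) := by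
    simp [mobius, linNum, linDen, hι, RatFunc.algebraMap_C, RatFunc.algebraMap_X]
  have hval : ∀ p : F[X], p.natDegree ≤ s → ι (homEval s p (linNum A) (linDen A))
      = ι (linDen A) ^ s * eval₂ RatFunc.C (mobius A) p := by
    intro p hp
    rw [map_homEval, homEval_eq_pow_mul_aeval hp _ hw, hmob, aeval_def,
      RatFunc.algebraMap_eq_C]
  set N' := homEval s Q.num (linNum A) (linDen A) with hN'
  set D' := homEval s Q.denom (linNum A) (linDen A) with hD'
  have hquot : ι N' / ι D' = Q := by
    rw [hval _ hNdeg.le, hval _ hDdeg.le, mul_div_mul_left _ _ (pow_ne_zero s hw)]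
    exact hinv
  have hN'0 : N' ≠ 0 := by
    intro h
    rw [h, map_zero, zero_div] at hquot
    exact hQ0 hquot.symm
  have hD'0 : D' ≠ 0 := by
    intro h
    rw [h, map_zero, div_zero] at hquot
    exact hQ0 hquot.symm
  have hcross : N' * Q.denom = Q.num * D' := by
    apply hιinj
    have h2 : ι N' / ι D' = ι Q.num / ι Q.denom := hquot.trans (RatFunc.num_div_denom Q).symm
    rw [div_eq_div_iff ((map_ne_zero_iff ι hιinj).2 hD'0)
      ((map_ne_zero_iff ι hιinj).2 Q.denom_ne_zero)] at h2
    rw [map_mul, map_mul, h2]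
  obtain ⟨t, ht⟩ : Q.num ∣ N' :=
    (RatFunc.isCoprime_num_denom Q).dvd_of_dvd_mul_right ⟨D', hcross⟩
  have ht0 : t ≠ 0 := by
    rintro rfl
    exact hN'0 (by rw [ht, mul_zero])
  have htdeg : t.natDegree = 0 := by
    have h1 : N'.natDegree ≤ s := natDegree_homEval_le A s _
    rw [ht, natDegree_mul hN ht0, hNdeg] at h1
    lia
  rw [eq_C_of_natDegree_eq_zero htdeg] at ht ht0
  have ht' : D' = C (t.coeff 0) * Q.denom := by
    apply mul_left_cancel₀ hN
    rw [← hcross, ht]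
    ring
  refine ⟨t.coeff 0, fun h => ht0 (by rw [h, C_0]), ?_, ?_⟩
  · rw [monicNum, homEval_C_mul, ← hN', ht, algebraMap_eq]
    ring
  · rw [denomOfMonicNum, homEval_C_mul, ← hD', ht', algebraMap_eq]
    ring

end

end RationalTransform

/-! ### The projective line: Möbius maps, Frobenius and twisted fixed points -/

namespace RationalTransform

open Polynomial OnePoint
open scoped MatrixGroups

noncomputable section

section Frobenius

variable (F K : Type*) [Monoid K]

/-- The `q`-power Frobenius map of the projective line over `K`, where `q = |F|`. -/
def frob : OnePoint K → OnePoint K := OnePoint.map fun x => x ^ Nat.card F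

theorem iterate_frob_coe (n : ℕ) (x : K) :
    (frob F K)^[n] (x : OnePoint K) = ((x ^ Nat.card F ^ n : K) : OnePoint K) := by
  induction n with
  | zero => simp
  | succ n ih =>
    rw [Function.iterate_succ_apply', ih, frob, OnePoint.map_some, ← pow_mul, pow_succ]

theorem iterate_frob_infty (n : ℕ) : (frob F K)^[n] ∞ = ∞ :=
  Function.iterate_fixed rfl n

end Frobenius

section Mob

variable {F : Type*} [Field F] (K : Type*) [Field K] [Algebra F K]

theorem aeval_linNum (A : GL (Fin 2) F) (x : K) :
    aeval x (linNum A) = algebraMap F K (A 0 0) * x + algebraMap F K (A 0 1) := by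
  simp [linNum]

theorem aeval_linDen (A : GL (Fin 2) F) (x : K) :
    aeval x (linDen A) = algebraMap F K (A 1 0) * x + algebraMap F K (A 1 1) := by
  simp [linDen]

theorem algebraMap_det_ne_zero (A : GL (Fin 2) F) :
    algebraMap F K (A 0 0) * algebraMap F K (A 1 1)
      - algebraMap F K (A 0 1) * algebraMap F K (A 1 0) ≠ 0 := by
  rw [← map_mul, ← map_mul, ← map_sub]
  exact (map_ne_zero_iff _ (algebraMap F K).injective).2 (det_ne_zero' A)

variable [DecidableEq K]

/-- The Möbius transformation of the projective line over `K` given by a matrix over `F`. -/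
def mob (A : GL (Fin 2) F) (p : OnePoint K) : OnePoint K :=
  A.map (algebraMap F K) • p

theorem mob_coe (A : GL (Fin 2) F) (x : K) : mob K A (x : OnePoint K) =
    if aeval x (linDen A) = 0 then ∞
    else ((aeval x (linNum A) / aeval x (linDen A) : K) : OnePoint K) := by
  simp [mob, smul_some_eq_ite, linDen, linNum]

theorem mob_infty (A : GL (Fin 2) F) : mob K A ∞ =
    if algebraMap F K (A 1 0) = 0 then ∞
    else ((algebraMap F K (A 0 0 / A 1 0) : K) : OnePoint K) := by
  rw [mob, smul_infty_eq_ite, map_div₀]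
  rfl

theorem mob_mul (A B : GL (Fin 2) F) (p : OnePoint K) :
    mob K (A * B) p = mob K A (mob K B p) := by
  simp [mob, mul_smul]

theorem mob_one (p : OnePoint K) : mob K (1 : GL (Fin 2) F) p = p := by
  simp [mob]

theorem mob_injective (A : GL (Fin 2) F) : Function.Injective (mob K A) :=
  MulAction.injective _

theorem iterate_mob (A : GL (Fin 2) F) (i : ℕ) : (mob K A)^[i] = mob K (A ^ i) := by
  induction i with
  | zero => funext p; simp [mob_one]
  | succ i ih => funext p; rw [Function.iterate_succ_apply', ih, pow_succ', mob_mul]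

theorem mob_scalar (u : Fˣ) (p : OnePoint K) :
    mob K (Matrix.GeneralLinearGroup.scalar (Fin 2) u) p = p := by
  induction p using OnePoint.rec with
  | infty => simp [mob_infty]
  | coe x => simp [mob_coe, linNum, linDen]

theorem mob_eq_of_mk_eq {A B : GL (Fin 2) F}
    (h : Matrix.ProjGenLinGroup.mk A = Matrix.ProjGenLinGroup.mk B) : mob K A = mob K B := by
  obtain ⟨u, rfl⟩ := Matrix.ProjGenLinGroup.mk_eq_mk_iff.1 h
  funext p
  rw [mob_mul, mob_scalar]

/-- In the equation `[A] ∘ x = y` the denominator may be cleared, because numerator and denominator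
do not vanish simultaneously. -/
theorem mob_coe_eq_coe_iff (A : GL (Fin 2) F) (x y : K) :
    mob K A (x : OnePoint K) = (y : OnePoint K) ↔
      y * aeval x (linDen A) = aeval x (linNum A) := by
  rw [mob_coe]
  split_ifs with h
  · simp only [h, mul_zero, OnePoint.infty_ne_coe, false_iff]
    intro h'
    rw [aeval_linDen] at h
    rw [aeval_linNum] at h'
    apply algebraMap_det_ne_zero K A
    by_cases hc : algebraMap F K (A 1 0) = 0
    · rw [hc, zero_mul, zero_add] at h
      rw [hc, h]; ring
    · have : x = - algebraMap F K (A 1 1) / algebraMap F K (A 1 0) := by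
        field_simp
        linear_combination h
      rw [this] at h'
      field_simp at h'
      linear_combination h'
  · rw [OnePoint.coe_eq_coe, div_eq_iff h, eq_comm]

theorem frob_mob [Finite F] (A : GL (Fin 2) F) (p : OnePoint K) :
    frob F K (mob K A p) = mob K A (frob F K p) := by
  have := Fintype.ofFinite F
  have h : frob F K = OnePoint.map (FiniteField.frobeniusAlgHom F K : K →+* K) := by
    funext p
    simp [frob, FiniteField.coe_frobeniusAlgHom, Nat.card_eq_fintype_card]
  rw [h, mob, OnePoint.map_smul, mob]
  congr 1
  ext i j
  simp

/-- Every Möbius twist of `Frob ^ n` has `q ^ n + 1` fixed points on the projective line: the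
equation `x ^ (q ^ n) = [A] ∘ x` is a separable polynomial equation for the finite ones, of degree
`q ^ n` if `[A]` fixes `∞` and `q ^ n + 1` otherwise. -/
theorem ncard_iterate_frob_eq_mob [Finite F] [IsAlgClosed K] (A : GL (Fin 2) F) {n : ℕ}
    (hn : 0 < n) :
    {p : OnePoint K | (frob F K)^[n] p = mob K A p}.ncard = Nat.card F ^ n + 1 := by
  have hN : 1 < Nat.card F ^ n := Nat.one_lt_pow hn.ne' Finite.one_lt_card
  have hNK : ((Nat.card F ^ n : ℕ) : K) = 0 := by
    have h0 : ((Nat.card F : ℕ) : F) = 0 := by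
      have := Fintype.ofFinite F
      rw [Nat.card_eq_fintype_card]
      exact FiniteField.cast_card_eq_zero F
    have h1 := congrArg (algebraMap F K) h0
    rw [map_natCast, map_zero] at h1
    rw [Nat.cast_pow, h1, zero_pow hn.ne']
  set N := Nat.card F ^ n with hNdef
  set a := algebraMap F K (A 0 0) with ha
  set b := algebraMap F K (A 0 1) with hb
  set c := algebraMap F K (A 1 0) with hc
  set d := algebraMap F K (A 1 1) with hd
  have hdet : a * d - b * c ≠ 0 := algebraMap_det_ne_zero K A
  let T : K[X] := (C c * X + C d) * X ^ N - (C a * X + C b)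
  have hlin : (C c * X + C d : K[X]) ≠ 0 := by
    intro h
    have h0 : d = 0 := by simpa using congrArg (fun p => coeff p 0) h
    have h1 : c = 0 := by simpa using congrArg (fun p => coeff p 1) h
    exact hdet (by rw [h0, h1]; ring)
  have hTdeg : T.natDegree = (C c * X + C d : K[X]).natDegree + N := by
    have h1 : ((C c * X + C d : K[X]) * X ^ N).natDegree
        = (C c * X + C d : K[X]).natDegree + N := natDegree_mul_X_pow N hlin
    rw [← h1]
    apply natDegree_sub_eq_left_of_natDegree_lt
    rw [h1]
    exact lt_of_le_of_lt natDegree_linear_le (by lia)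
  have hT0 : T ≠ 0 := by
    intro h
    rw [h, natDegree_zero] at hTdeg
    lia
  have hsep : T.Separable := by
    have hder : derivative T = C c * X ^ N - C a := by
      have hNK' : (C (N : K) : K[X]) = 0 := by rw [hNK, C_0]
      simp only [T, derivative_sub, derivative_mul, derivative_add, derivative_C, derivative_X,
        derivative_X_pow, hNK']
      ring
    refine ⟨C (a * d - b * c)⁻¹ * C c, - (C (a * d - b * c)⁻¹ * (C c * X + C d)), ?_⟩
    have : (C (a * d - b * c)⁻¹ : K[X]) * (C a * C d - C b * C c) = 1 := by
      rw [← C_mul, ← C_mul, ← C_sub, ← C_mul, inv_mul_cancel₀ hdet, C_1]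
    rw [hder, ← this]
    simp only [T]
    ring
  have hroots : {x : K | T.IsRoot x}.ncard = T.natDegree := by
    rw [← IsAlgClosed.card_roots_eq_natDegree, ← Multiset.toFinset_card_of_nodup (nodup_roots hsep),
      ← Set.ncard_coe_finset]
    congr 1
    ext x
    simp [hT0]
  have hfin : {x : K | T.IsRoot x}.Finite := by
    refine (T.roots.toFinset.finite_toSet).subset fun x hx => ?_
    simpa [hT0] using hx
  have hcoe : ∀ x : K, (frob F K)^[n] (x : OnePoint K) = mob K A x ↔ T.IsRoot x := by
    intro x
    rw [iterate_frob_coe, eq_comm, mob_coe_eq_coe_iff, aeval_linDen, aeval_linNum, IsRoot.def]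
    simp only [T, eval_sub, eval_mul, eval_add, eval_C, eval_X, eval_pow, sub_eq_zero]
    rw [mul_comm]
  have hinj : Function.Injective ((↑) : K → OnePoint K) := OnePoint.coe_injective
  have himg : (((↑) : K → OnePoint K) '' {x : K | T.IsRoot x}).ncard = T.natDegree := by
    rw [Set.ncard_image_of_injective _ hinj, hroots]
  by_cases hc0 : c = 0
  · have hset : {p : OnePoint K | (frob F K)^[n] p = mob K A p}
        = insert ∞ (((↑) : K → OnePoint K) '' {x : K | T.IsRoot x}) := by
      ext p
      induction p using OnePoint.rec with
      | infty => simp [iterate_frob_infty, mob_infty, ← hc, hc0]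
      | coe x => simp [hcoe]
    rw [hset, Set.ncard_insert_of_notMem (by simp) (hfin.image _), himg, hTdeg, hc0]
    simp
  · have hset : {p : OnePoint K | (frob F K)^[n] p = mob K A p}
        = ((↑) : K → OnePoint K) '' {x : K | T.IsRoot x} := by
      ext p
      induction p using OnePoint.rec with
      | infty => simp [iterate_frob_infty, mob_infty, ← hc, hc0]
      | coe x => simp [hcoe]
    rw [hset, himg, hTdeg, natDegree_linear hc0, add_comm]

end Mob

end

end RationalTransform

/-! ### Fibres of the quotient map -/

namespace RationalTransform

open Polynomial OnePoint
open scoped MatrixGroups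

noncomputable section

variable {F : Type*} [Field F]

/-- `g / h` is an invariant fraction of degree `s` for the group `G` of prime order `s` generated
by the class of `A`. -/
structure IsPrimeQuotient (G : Subgroup PGL(2, F)) (A : GL (Fin 2) F) (s : ℕ) (g h : F[X]) : Prop
    extends IsInvariantFraction G s g h where
  prime : s.Prime
  card_eq : Nat.card G = s
  mem : Matrix.ProjGenLinGroup.mk A ∈ G
  ne_one : Matrix.ProjGenLinGroup.mk A ≠ 1

variable (K : Type*) [Field K] [Algebra F K]

namespace IsPrimeQuotient

variable {K} {G : Subgroup PGL(2, F)} {A : GL (Fin 2) F} {s : ℕ} {g h : F[X]}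

theorem aeval_num_ne_zero (H : IsPrimeQuotient G A s g h) {x : K} (hx : aeval x h = 0) :
    aeval x g ≠ 0 := by
  obtain ⟨u, v, huv⟩ := H.isCoprime
  intro hg
  have := congrArg (aeval x) huv
  simp [hg, hx] at this

theorem homEval_at (H : IsPrimeQuotient G A s g h) {B : GL (Fin 2) F}
    (hB : Matrix.ProjGenLinGroup.mk B ∈ G) : ∃ c : K, c ≠ 0 ∧ ∀ x : K,
      homEval s g (aeval x (linNum B)) (aeval x (linDen B)) = c * aeval x g ∧
      homEval s h (aeval x (linNum B)) (aeval x (linDen B)) = c * aeval x h := by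
  obtain ⟨c, hc, h1, h2⟩ := H.exists_factor B hB
  refine ⟨algebraMap F K c, (map_ne_zero_iff _ (algebraMap F K).injective).2 hc, fun x => ?_⟩
  rw [← map_homEval, ← map_homEval, h1, h2]
  simp

/-- The polynomial `g - y h`, whose roots are the points above `y`. -/
def fiberPoly (g h : F[X]) (y : K) : K[X] :=
  g.map (algebraMap F K) - C y * h.map (algebraMap F K)

theorem eval_fiberPoly (x y : K) : (fiberPoly g h y).eval x = aeval x g - y * aeval x h := by
  simp [fiberPoly, eval_map_algebraMap]

theorem monic_fiberPoly (H : IsPrimeQuotient G A s g h) (y : K) :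
    (fiberPoly g h y).Monic ∧ (fiberPoly g h y).natDegree = s := by
  have hlt : (C y * h.map (algebraMap F K)).degree < (g.map (algebraMap F K)).degree := by
    rw [← smul_eq_C_mul]
    refine lt_of_le_of_lt (degree_smul_le _ _) ?_
    rw [degree_map, degree_map]
    exact degree_lt_degree (H.natDegree_num.symm ▸ H.natDegree_denom_lt)
  refine ⟨(H.monic.map _).sub_of_left hlt, ?_⟩
  rw [fiberPoly, natDegree_eq_of_degree_eq (degree_sub_eq_left_of_degree_lt hlt), natDegree_map,
    H.natDegree_num]

end IsPrimeQuotient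

variable [DecidableEq K]

/-- The self-map `x ↦ g x / h x` of the projective line, for coprime `g` and `h` with
`deg h < deg g`, so that `∞` is mapped to `∞`. -/
def ratMap (g h : F[X]) (p : OnePoint K) : OnePoint K :=
  p.elim ∞ fun x => if aeval x h = 0 then ∞ else ((aeval x g / aeval x h : K) : OnePoint K)

theorem ratMap_infty (g h : F[X]) : ratMap K g h ∞ = ∞ := rfl

theorem ratMap_coe (g h : F[X]) (x : K) : ratMap K g h (x : OnePoint K) =
    if aeval x h = 0 then ∞ else ((aeval x g / aeval x h : K) : OnePoint K) := rfl

theorem frob_ratMap [Finite F] (g h : F[X]) (p : OnePoint K) :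
    frob F K (ratMap K g h p) = ratMap K g h (frob F K p) := by
  have := Fintype.ofFinite F
  have hpow : ∀ (x : K), x ^ Nat.card F = FiniteField.frobeniusAlgHom F K x := by
    intro x
    rw [FiniteField.coe_frobeniusAlgHom, Nat.card_eq_fintype_card]
  induction p using OnePoint.rec with
  | infty => rfl
  | coe x =>
    rw [ratMap_coe, frob, OnePoint.map_some, ratMap_coe]
    simp only [hpow, aeval_algHom_apply]
    by_cases hx : aeval x h = 0
    · simp [hx]
    · rw [if_neg hx, if_neg (by simpa using hx), OnePoint.map_some]
      simp only [map_div₀]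

namespace IsPrimeQuotient

variable {K} {G : Subgroup PGL(2, F)} {A : GL (Fin 2) F} {s : ℕ} {g h : F[X]}

theorem ratMap_coe_eq_coe_iff (H : IsPrimeQuotient G A s g h) (x y : K) :
    ratMap K g h (x : OnePoint K) = y ↔ aeval x g = y * aeval x h := by
  rw [ratMap_coe]
  split_ifs with hx
  · simpa [hx] using H.aeval_num_ne_zero hx
  · rw [OnePoint.coe_eq_coe, div_eq_iff hx]

theorem ratMap_coe_eq_infty_iff (x : K) :
    ratMap K g h (x : OnePoint K) = ∞ ↔ aeval x h = 0 := by
  rw [ratMap_coe]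
  split_ifs with hx <;> simp [hx]

theorem ratMap_mob (H : IsPrimeQuotient G A s g h) {B : GL (Fin 2) F}
    (hB : Matrix.ProjGenLinGroup.mk B ∈ G) (p : OnePoint K) :
    ratMap K g h (mob K B p) = ratMap K g h p := by
  have key : ∀ B : GL (Fin 2) F, Matrix.ProjGenLinGroup.mk B ∈ G → ∀ x : K,
      ratMap K g h (mob K B (x : OnePoint K)) = ratMap K g h (x : OnePoint K) := by
    intro B hB x
    obtain ⟨c, hc, hx⟩ := H.homEval_at (K := K) hB
    obtain ⟨h1, h2⟩ := hx x
    rw [mob_coe]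
    split_ifs with hv
    · rw [hv, homEval_zero_right, coeff_eq_zero_of_natDegree_lt H.natDegree_denom_lt, map_zero,
        zero_mul] at h2
      rw [ratMap_infty, eq_comm, ratMap_coe_eq_infty_iff]
      exact (mul_eq_zero.1 h2.symm).resolve_left hc
    · have hvs := pow_ne_zero s hv
      rw [homEval_eq_pow_mul_aeval H.natDegree_num.le _ hv] at h1
      rw [homEval_eq_pow_mul_aeval H.natDegree_denom_lt.le _ hv] at h2
      rw [ratMap_coe, ratMap_coe]
      by_cases hx0 : aeval x h = 0
      · rw [hx0, mul_zero] at h2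
        rw [if_pos hx0, if_pos ((mul_eq_zero.1 h2).resolve_left hvs)]
      · rw [if_neg hx0, if_neg, ← mul_div_mul_left _ _ hvs, h1, h2, mul_div_mul_left _ _ hc]
        intro h0
        rw [h0, mul_zero] at h2
        exact (mul_ne_zero hc hx0) h2.symm
  induction p using OnePoint.rec with
  | coe x => exact key B hB x
  | infty =>
    by_cases hp : mob K B ∞ = ∞
    · rw [hp]
    · obtain ⟨x, hx⟩ := OnePoint.ne_infty_iff_exists.1 hp
      have hinv : mob K B⁻¹ (x : OnePoint K) = ∞ := by
        rw [hx, ← mob_mul, inv_mul_cancel, mob_one]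
      rw [← hx, ← key B⁻¹ (by rw [map_inv]; exact G.inv_mem hB) x, hinv]

theorem iterate_mob_card (H : IsPrimeQuotient G A s g h) (p : OnePoint K) :
    (mob K A)^[s] p = p := by
  have h1 : Matrix.ProjGenLinGroup.mk (A ^ s) = Matrix.ProjGenLinGroup.mk (1 : GL (Fin 2) F) := by
    have h2 : (⟨_, H.mem⟩ : G) ^ Nat.card G = 1 := pow_card_eq_one'
    rw [map_pow, map_one, ← H.card_eq]
    exact congrArg Subtype.val h2
  rw [iterate_mob, mob_eq_of_mk_eq K h1, mob_one]

theorem exists_mob_eq_iterate (H : IsPrimeQuotient G A s g h) {B : GL (Fin 2) F}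
    (hB : Matrix.ProjGenLinGroup.mk B ∈ G) : ∃ i, mob K B = (mob K A)^[i] := by
  have := Fact.mk H.prime
  obtain ⟨i, hi⟩ := mem_powers_of_prime_card (g := (⟨_, H.mem⟩ : G)) (g' := ⟨_, hB⟩) H.card_eq
    (fun h => H.ne_one (congrArg Subtype.val h))
  refine ⟨i, ?_⟩
  rw [iterate_mob]
  apply mob_eq_of_mk_eq
  rw [map_pow]
  exact (congrArg Subtype.val hi).symm

theorem ratMap_iterate_mob (H : IsPrimeQuotient G A s g h) (i : ℕ) (p : OnePoint K) :
    ratMap K g h ((mob K A)^[i] p) = ratMap K g h p := by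
  induction i with
  | zero => rfl
  | succ i ih => rw [Function.iterate_succ_apply', H.ratMap_mob H.mem, ih]

theorem denom_ne_zero (H : IsPrimeQuotient G A s g h) : h ≠ 0 := by
  rintro rfl
  have h1 := natDegree_eq_zero_of_isUnit (isCoprime_zero_right.1 H.isCoprime)
  exact H.prime.ne_zero (H.natDegree_num.symm.trans h1)

theorem isRoot_fiberPoly (H : IsPrimeQuotient G A s g h) (x y : K) :
    (fiberPoly g h y).IsRoot x ↔ ratMap K g h (x : OnePoint K) = y := by
  rw [H.ratMap_coe_eq_coe_iff, IsRoot.def, eval_fiberPoly, sub_eq_zero]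

/-- Every fibre of the quotient map has at most `s` points. -/
theorem fiber_finite_ncard_le (H : IsPrimeQuotient G A s g h) (y : OnePoint K) :
    {p | ratMap K g h p = y}.Finite ∧ {p | ratMap K g h p = y}.ncard ≤ s := by
  classical
  suffices ∃ t : Finset (OnePoint K), {p | ratMap K g h p = y} ⊆ t ∧ t.card ≤ s by
    obtain ⟨t, ht, hts⟩ := this
    refine ⟨t.finite_toSet.subset ht, (Set.ncard_le_ncard ht t.finite_toSet).trans ?_⟩
    rwa [Set.ncard_coe_finset]
  induction y using OnePoint.rec with
  | infty =>
    refine ⟨insert ∞ ((h.map (algebraMap F K)).roots.toFinset.image (↑)), ?_, ?_⟩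
    · intro p hp
      induction p using OnePoint.rec with
      | infty => simp
      | coe x =>
        have h0 : h.map (algebraMap F K) ≠ 0 :=
          (Polynomial.map_ne_zero_iff (algebraMap F K).injective).2 H.denom_ne_zero
        have hx : aeval x h = 0 := (ratMap_coe_eq_infty_iff x).1 hp
        simp only [Finset.coe_insert, Set.mem_insert_iff, OnePoint.coe_ne_infty, false_or,
          Finset.coe_image, Set.mem_image]
        exact ⟨x, by simp [h0, eval_map_algebraMap, hx], rfl⟩
    · have h1 := (Finset.card_insert_le (∞ : OnePoint K)
        ((h.map (algebraMap F K)).roots.toFinset.image (↑)))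
      have h2 := (Finset.card_image_le (s := (h.map (algebraMap F K)).roots.toFinset)
        (f := ((↑) : K → OnePoint K)))
      have h3 := Multiset.toFinset_card_le (h.map (algebraMap F K)).roots
      have h4 := card_roots' (h.map (algebraMap F K))
      have h5 := H.natDegree_denom_lt
      rw [natDegree_map] at h4
      lia
  | coe y =>
    have hP := H.monic_fiberPoly y
    refine ⟨(fiberPoly g h y).roots.toFinset.image (↑), ?_, ?_⟩
    · intro p hp
      induction p using OnePoint.rec with
      | infty => exact absurd hp (OnePoint.infty_ne_coe y)
      | coe x =>
        simp only [Finset.coe_image, Set.mem_image]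
        refine ⟨x, ?_, rfl⟩
        rw [Finset.mem_coe, Multiset.mem_toFinset, mem_roots hP.1.ne_zero]
        exact (H.isRoot_fiberPoly x y).2 hp
    · refine Finset.card_image_le.trans ((Multiset.toFinset_card_le _).trans ?_)
      exact hP.2 ▸ card_roots' _

theorem ncard_orbit (H : IsPrimeQuotient G A s g h) {p : OnePoint K} (hp : mob K A p ≠ p) :
    ((fun i => (mob K A)^[i] p) '' (Finset.range s : Set ℕ)).ncard = s := by
  rw [Set.InjOn.ncard_image, Set.ncard_coe_finset, Finset.card_range]
  intro i hi j hj hij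
  exact iterate_injOn_range H.prime H.iterate_mob_card hp (by simpa using hi)
    (by simpa using hj) hij

/-- The fibre through a point moved by `A` is its orbit, because the orbit already has `s`
elements. -/
theorem fiber_eq_orbit (H : IsPrimeQuotient G A s g h) {p : OnePoint K} (hp : mob K A p ≠ p) :
    {p' | ratMap K g h p' = ratMap K g h p}
      = (fun i => (mob K A)^[i] p) '' (Finset.range s : Set ℕ) := by
  obtain ⟨hfin, hle⟩ := H.fiber_finite_ncard_le (ratMap K g h p)
  refine (Set.eq_of_subset_of_ncard_le ?_ ?_ hfin).symm
  · rintro _ ⟨i, -, rfl⟩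
    exact H.ratMap_iterate_mob i p
  · rwa [H.ncard_orbit hp]

theorem exists_iterate_eq (H : IsPrimeQuotient G A s g h) (p p' : OnePoint K)
    (hp : mob K A p ≠ p) (hpp' : ratMap K g h p' = ratMap K g h p) :
    ∃ i, p' = (mob K A)^[i] p := by
  have h1 : p' ∈ {p' | ratMap K g h p' = ratMap K g h p} := hpp'
  rw [H.fiber_eq_orbit hp] at h1
  obtain ⟨i, -, rfl⟩ := h1
  exact ⟨i, rfl⟩

theorem ncard_fiber (H : IsPrimeQuotient G A s g h) {p : OnePoint K} (hp : mob K A p ≠ p) :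
    {p' | ratMap K g h p' = ratMap K g h p}.ncard = s := by
  rw [H.fiber_eq_orbit hp, H.ncard_orbit hp]

theorem mob_ne_self_of_ratMap_eq (H : IsPrimeQuotient G A s g h) {p p' : OnePoint K}
    (hp : mob K A p ≠ p) (hpp' : ratMap K g h p' = ratMap K g h p) : mob K A p' ≠ p' := by
  obtain ⟨i, rfl⟩ := H.exists_iterate_eq p p' hp hpp'
  intro h'
  rw [← Function.iterate_succ_apply' (mob K A), Function.iterate_succ_apply] at h'
  exact hp ((mob_injective K A).iterate i h')

theorem exists_ratMap_eq [IsAlgClosed K] (H : IsPrimeQuotient G A s g h) (y : K) :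
    ∃ x : K, ratMap K g h (x : OnePoint K) = y := by
  have hP := H.monic_fiberPoly y
  obtain ⟨x, hx⟩ := IsAlgClosed.exists_root (fiberPoly g h y) (by
    intro h0
    have := natDegree_eq_of_degree_eq_some h0
    exact H.prime.ne_zero (hP.2.symm.trans this))
  exact ⟨x, (H.isRoot_fiberPoly x y).1 hx⟩

theorem not_scalar (H : IsPrimeQuotient G A s g h) :
    ¬ (A 1 0 = 0 ∧ A 0 1 = 0 ∧ A 0 0 = A 1 1) := by
  rintro ⟨hc, hb, had⟩
  apply H.ne_one
  have ha : A 0 0 ≠ 0 := by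
    intro h0
    apply det_ne_zero' A
    rw [h0, hb]; ring
  have hA : A = Matrix.GeneralLinearGroup.scalar (Fin 2) (Units.mk0 _ ha) := by
    ext i j
    fin_cases i <;> fin_cases j <;> simp [hc, hb, ← had]
  rw [hA, Matrix.ProjGenLinGroup.mk_scalar]

theorem mob_coe_eq_self_iff (x : K) : mob K A (x : OnePoint K) = x ↔
    algebraMap F K (A 1 0) * x ^ 2 + (algebraMap F K (A 1 1) - algebraMap F K (A 0 0)) * x
      - algebraMap F K (A 0 1) = 0 := by
  rw [mob_coe_eq_coe_iff, aeval_linDen, aeval_linNum]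
  constructor <;> intro h <;> linear_combination h

/-- If `A` has two distinct finite fixed points, the quadratic equation `c x ^ 2 + (d - a) x = b` of
its fixed points is genuinely quadratic, as `A` is not scalar, and they are its two roots. -/
theorem fixedPoint_relations (H : IsPrimeQuotient G A s g h) {x₁ x₂ : K} (hx : x₁ ≠ x₂)
    (h1 : mob K A (x₁ : OnePoint K) = x₁) (h2 : mob K A (x₂ : OnePoint K) = x₂) :
    algebraMap F K (A 1 0) ≠ 0 ∧ algebraMap F K (A 1 0) * (x₁ + x₂)
      = algebraMap F K (A 0 0) - algebraMap F K (A 1 1) := by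
  rw [mob_coe_eq_self_iff] at h1 h2
  have hsum : algebraMap F K (A 1 0) * (x₁ + x₂)
      = algebraMap F K (A 0 0) - algebraMap F K (A 1 1) := by
    apply mul_right_cancel₀ (sub_ne_zero.2 hx)
    linear_combination h1 - h2
  refine ⟨fun hc => H.not_scalar ?_, hsum⟩
  have hinj := (algebraMap F K).injective
  rw [hc, zero_mul] at hsum
  have had : algebraMap F K (A 0 0) = algebraMap F K (A 1 1) := by linear_combination -hsum
  refine ⟨(map_eq_zero_iff _ hinj).1 hc, (map_eq_zero_iff _ hinj).1 ?_, hinj had⟩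
  rw [hc, had] at h1
  linear_combination -h1

/-- Distinct fixed points of `A` lie in distinct fibres: if `g - y h = (x - x₁) ^ k (x - x₂) ^ l`
with `k + l = s`, comparing the semi-invariance factor at `x₁`, at `x₂` and at a generic point shows
that the ratio of the eigenvalues of `A` is killed by both `k` and the prime `s`. -/
theorem eq_of_ratMap_eq_of_fixed [IsAlgClosed K] (H : IsPrimeQuotient G A s g h) {x₁ x₂ y : K}
    (h1 : mob K A (x₁ : OnePoint K) = x₁) (h2 : mob K A (x₂ : OnePoint K) = x₂)
    (hy1 : ratMap K g h (x₁ : OnePoint K) = y) (hy2 : ratMap K g h (x₂ : OnePoint K) = y) :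
    x₁ = x₂ := by
  by_contra hx
  obtain ⟨hc, hsum⟩ := H.fixedPoint_relations hx h1 h2
  obtain ⟨hPm, hPdeg⟩ := H.monic_fiberPoly y
  set P := fiberPoly g h y with hP
  have hroot : ∀ z, z ∈ P.roots → z = x₁ ∨ z = x₂ := by
    intro z hz
    have hzy := (H.isRoot_fiberPoly z y).1 ((mem_roots hPm.ne_zero).1 hz)
    have hfix : mob K A (z : OnePoint K) = z := by
      by_contra hne
      exact H.mob_ne_self_of_ratMap_eq hne (hy1.trans hzy.symm) h1
    by_contra! hne
    have h3 := (H.fixedPoint_relations hne.1.symm h1 hfix).2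
    have h4 : algebraMap F K (A 1 0) * (x₂ - z) = 0 := by linear_combination hsum - h3
    exact hne.2 (sub_eq_zero.1 ((mul_eq_zero.1 h4).resolve_left hc)).symm
  obtain ⟨k, l, hk, hl, hkl, hfac⟩ : ∃ k l, 0 < k ∧ 0 < l ∧ k + l = s ∧
      ∀ x, P.eval x = (x - x₁) ^ k * (x - x₂) ^ l := by
    have hx1 : x₁ ∈ P.roots := (mem_roots hPm.ne_zero).2 ((H.isRoot_fiberPoly x₁ y).2 hy1)
    have hx2 : x₂ ∈ P.roots := (mem_roots hPm.ne_zero).2 ((H.isRoot_fiberPoly x₂ y).2 hy2)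
    have hr : P.roots = Multiset.replicate (P.roots.count x₁) x₁
        + Multiset.replicate (P.roots.count x₂) x₂ := by
      ext z
      rw [Multiset.count_add, Multiset.count_replicate, Multiset.count_replicate]
      by_cases hz : z ∈ P.roots
      · rcases hroot z hz with rfl | rfl
        · simp [Ne.symm hx]
        · simp [hx]
      · have hz1 : x₁ ≠ z := fun h' => hz (h' ▸ hx1)
        have hz2 : x₂ ≠ z := fun h' => hz (h' ▸ hx2)
        simp [hz1, hz2, Multiset.count_eq_zero_of_notMem hz]
    refine ⟨P.roots.count x₁, P.roots.count x₂, Multiset.count_pos.2 hx1, Multiset.count_pos.2 hx2,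
      ?_, fun x => ?_⟩
    · have := congrArg Multiset.card hr
      rw [Multiset.card_add, Multiset.card_replicate, Multiset.card_replicate,
        IsAlgClosed.card_roots_eq_natDegree, hPdeg] at this
      exact this.symm
    · have h5 : P = (P.roots.map fun r => X - C r).prod :=
        ((IsAlgClosed.splits P).eq_prod_roots_of_monic hPm)
      have h6 := congrArg (eval x) h5
      rw [hr, Multiset.map_add, Multiset.prod_add, Multiset.map_replicate, Multiset.map_replicate,
        Multiset.prod_replicate, Multiset.prod_replicate] at h6
      simpa only [eval_mul, eval_pow, eval_sub, eval_X, eval_C] using h6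
  obtain ⟨e, he, hform⟩ := H.homEval_at (K := K) H.mem
  set a := algebraMap F K (A 0 0)
  set b := algebraMap F K (A 0 1)
  set c := algebraMap F K (A 1 0)
  set d := algebraMap F K (A 1 1)
  -- the factor is the `s`-th power of either eigenvalue
  have heig : ∀ x : K, mob K A (x : OnePoint K) = x → ratMap K g h (x : OnePoint K) = y →
      c * x + d ≠ 0 ∧ (c * x + d) ^ s = e := by
    intro x hfix hxy
    have hden : aeval x (linDen A) ≠ 0 := by
      intro h0
      rw [mob_coe, if_pos h0] at hfix
      exact OnePoint.infty_ne_coe x hfix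
    have hdiv : aeval x (linNum A) / aeval x (linDen A) = x := by
      rwa [mob_coe, if_neg hden, OnePoint.coe_eq_coe] at hfix
    have hx0 : aeval x h ≠ 0 := by
      intro h0
      rw [(ratMap_coe_eq_infty_iff x).2 h0] at hxy
      exact OnePoint.infty_ne_coe y hxy
    have h6 := (hform x).2
    rw [homEval_eq_pow_mul_aeval H.natDegree_denom_lt.le _ hden, hdiv] at h6
    rw [← aeval_linDen]
    exact ⟨hden, mul_right_cancel₀ hx0 h6⟩
  obtain ⟨hρ1, he1⟩ := heig x₁ h1 hy1
  obtain ⟨hρ2, he2⟩ := heig x₂ h2 hy2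
  set ρ₁ := c * x₁ + d
  set ρ₂ := c * x₂ + d
  -- the form attached to `g - y h` is the product of powers of two linear forms
  have hprod : ∀ u v : K, homEval s g u v - y * homEval s h u v
      = (u - x₁ * v) ^ k * (u - x₂ * v) ^ l := by
    intro u v
    by_cases hv : v = 0
    · rw [hv, homEval_zero_right, homEval_zero_right,
        coeff_eq_zero_of_natDegree_lt H.natDegree_denom_lt, ← H.natDegree_num,
        H.monic.coeff_natDegree, H.natDegree_num, ← hkl]
      simp [pow_add]
    · rw [homEval_eq_pow_mul_aeval H.natDegree_num.le _ hv,
        homEval_eq_pow_mul_aeval H.natDegree_denom_lt.le _ hv]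
      have h7 := hfac (u / v)
      rw [hP, eval_fiberPoly] at h7
      have h8 : ∀ r, u - r * v = v * (u / v - r) := by
        intro r
        field_simp
      rw [h8, h8, mul_pow, mul_pow, ← hkl, pow_add]
      linear_combination v ^ k * v ^ l * h7
  obtain ⟨x, hxn⟩ := Infinite.exists_notMem_finset ({x₁, x₂} : Finset K)
  simp only [Finset.mem_insert, Finset.mem_singleton, not_or] at hxn
  have hx1 := sub_ne_zero.2 hxn.1
  have hx2 := sub_ne_zero.2 hxn.2
  have h9 := hprod (aeval x (linNum A)) (aeval x (linDen A))
  rw [(hform x).1, (hform x).2] at h9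
  have h10 := hfac x
  rw [hP, eval_fiberPoly] at h10
  rw [mob_coe_eq_self_iff] at h1 h2
  have h11 : aeval x (linNum A) - x₁ * aeval x (linDen A) = ρ₂ * (x - x₁) := by
    rw [aeval_linNum, aeval_linDen]
    linear_combination (x₁ - x) * hsum - h1
  have h12 : aeval x (linNum A) - x₂ * aeval x (linDen A) = ρ₁ * (x - x₂) := by
    rw [aeval_linNum, aeval_linDen]
    linear_combination (x₂ - x) * hsum - h2
  rw [h11, h12, mul_pow, mul_pow] at h9
  have h13 : ρ₂ ^ k * ρ₁ ^ l = e := by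
    apply mul_right_cancel₀ (mul_ne_zero (pow_ne_zero k hx1) (pow_ne_zero l hx2))
    linear_combination e * h10 - h9
  have h14 : (ρ₂ / ρ₁) ^ k = 1 := by
    rw [div_pow, div_eq_one_iff_eq (pow_ne_zero k hρ1)]
    apply mul_right_cancel₀ (pow_ne_zero l hρ1)
    rw [h13, ← he1, ← hkl, pow_add]
  have h15 : (ρ₂ / ρ₁) ^ s = 1 := by
    rw [div_pow, he1, he2, div_self he]
  have h16 : Nat.gcd k s = 1 :=
    (H.prime.coprime_iff_not_dvd.2 (Nat.not_dvd_of_pos_of_lt hk (by lia))).symm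
  have h17 : ρ₂ / ρ₁ = 1 := by
    have := pow_gcd_eq_one.2 ⟨h14, h15⟩
    rwa [h16, pow_one] at this
  rw [div_eq_one_iff_eq hρ1] at h17
  have h18 : c * (x₁ - x₂) = 0 := by
    linear_combination -h17
  exact hx (sub_eq_zero.1 ((mul_eq_zero.1 h18).resolve_left hc))

theorem finite_fixed (H : IsPrimeQuotient G A s g h) :
    {x : K | mob K A (x : OnePoint K) = x}.Finite := by
  by_contra hfin
  have hinf : {x : K | mob K A (x : OnePoint K) = x}.Infinite := hfin
  obtain ⟨x₁, h1⟩ := hinf.nonempty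
  obtain ⟨x₂, h2, h21⟩ := hinf.exists_notMem_finset {x₁}
  obtain ⟨x₃, h3, h31⟩ := hinf.exists_notMem_finset {x₁, x₂}
  simp only [Finset.mem_insert, Finset.mem_singleton, not_or] at h21 h31
  obtain ⟨hc, hs2⟩ := H.fixedPoint_relations (Ne.symm h21) h1 h2
  obtain ⟨-, hs3⟩ := H.fixedPoint_relations (Ne.symm h31.1) h1 h3
  have h4 : algebraMap F K (A 1 0) * (x₂ - x₃) = 0 := by linear_combination hs2 - hs3
  exact h31.2 (sub_eq_zero.1 ((mul_eq_zero.1 h4).resolve_left hc)).symm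

/-- If `∞` is moved by `A`, then `A` has a finite fixed point. -/
theorem exists_fixed [IsAlgClosed K] (hinf : mob K A ∞ ≠ ∞) :
    ∃ x : K, mob K A (x : OnePoint K) = x := by
  have hc : algebraMap F K (A 1 0) ≠ 0 := by
    intro hc
    exact hinf (by rw [mob_infty, if_pos hc])
  obtain ⟨x, hx⟩ := IsAlgClosed.exists_root (C (algebraMap F K (A 1 0)) * X ^ 2
    + C (algebraMap F K (A 1 1) - algebraMap F K (A 0 0)) * X + C (-algebraMap F K (A 0 1)))
    (by rw [degree_quadratic hc]; decide)
  refine ⟨x, (mob_coe_eq_self_iff x).2 ?_⟩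
  simp only [IsRoot.def, eval_add, eval_mul, eval_C, eval_pow, eval_X] at hx
  linear_combination hx

end IsPrimeQuotient

end

end RationalTransform

/-! ### Irreducible polynomials and Frobenius periods -/

namespace RationalTransform

open Polynomial OnePoint Function
open scoped MatrixGroups

noncomputable section

variable {F : Type*} [Field F]

/-- If `deg h < deg g` and `g`, `f` are monic, the transform of `f` is monic of degree
`deg g * deg f`. -/
theorem monic_transform {g h f : F[X]} (hg : g.Monic) (hlt : h.natDegree < g.natDegree)
    (hf : f.Monic) :
    (transform g h f).Monic ∧ (transform g h f).natDegree = g.natDegree * f.natDegree := by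
  have htop : (g ^ f.natDegree).natDegree = g.natDegree * f.natDegree := by
    rw [hg.natDegree_pow, mul_comm]
  have hsplit : transform g h f = (∑ i ∈ Finset.range f.natDegree,
      C (f.coeff i) * g ^ i * h ^ (f.natDegree - i)) + g ^ f.natDegree := by
    rw [transform, Finset.sum_range_succ, hf.coeff_natDegree]
    simp
  have hdeg : (∑ i ∈ Finset.range f.natDegree,
      C (f.coeff i) * g ^ i * h ^ (f.natDegree - i)).degree < (g ^ f.natDegree).degree := by
    refine lt_of_le_of_lt (degree_sum_le _ _) ((Finset.sup_lt_iff ?_).2 ?_)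
    · exact bot_lt_iff_ne_bot.2 (degree_ne_bot.2 (hg.pow _).ne_zero)
    · intro i hi
      rw [Finset.mem_range] at hi
      apply degree_lt_degree
      rw [htop]
      have h1 : (C (f.coeff i) * g ^ i * h ^ (f.natDegree - i)).natDegree
          ≤ i * g.natDegree + (f.natDegree - i) * h.natDegree := by
        rw [mul_assoc]
        refine (natDegree_C_mul_le _ _).trans (natDegree_mul_le.trans ?_)
        exact Nat.add_le_add natDegree_pow_le natDegree_pow_le
      refine lt_of_le_of_lt h1 ?_
      obtain ⟨k, hk⟩ := Nat.exists_eq_add_of_lt hi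
      rw [hk, show i + k + 1 - i = k + 1 by lia]
      nlinarith
  rw [hsplit]
  refine ⟨(hg.pow _).add_of_right hdeg, ?_⟩
  rw [natDegree_eq_of_degree_eq (degree_add_eq_right_of_degree_lt hdeg), htop]

variable {K : Type*} [Field K] [Algebra F K]

theorem iterate_frob_eq_self_iff [Finite F] {f : F[X]} (hf : Irreducible f) {y : K}
    (hy : aeval y f = 0) (n : ℕ) :
    (frob F K)^[n] (y : OnePoint K) = y ↔ f.natDegree ∣ n := by
  rw [iterate_frob_coe, OnePoint.coe_eq_coe, hf.natDegree_dvd_iff_dvd_X_pow_card_pow_sub_X,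
    ← hf.dvd_iff_aeval_eq_zero hy]
  simp [sub_eq_zero]

theorem minimalPeriod_frob [Finite F] {f : F[X]} (hf : Irreducible f) {y : K}
    (hy : aeval y f = 0) : minimalPeriod (frob F K) (y : OnePoint K) = f.natDegree := by
  apply Nat.dvd_antisymm
  · exact IsPeriodicPt.minimalPeriod_dvd ((iterate_frob_eq_self_iff hf hy _).2 dvd_rfl)
  · exact (iterate_frob_eq_self_iff hf hy _).1 (isPeriodicPt_minimalPeriod _ _)

theorem minpoly_mem_monicIrred [Algebra.IsAlgebraic F K] (y : K) :
    minpoly F y ∈ monicIrred F (minpoly F y).natDegree := by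
  have hy : IsIntegral F y := Algebra.IsIntegral.isIntegral y
  exact ⟨minpoly.monic hy, minpoly.irreducible hy, rfl⟩

theorem minpoly_eq_iff_aeval_eq_zero {m : ℕ} {f : F[X]} (hf : f ∈ monicIrred F m) (y : K) :
    minpoly F y = f ↔ aeval y f = 0 := by
  constructor
  · rintro rfl
    exact minpoly.aeval F y
  · intro hy
    exact (minpoly.eq_of_irreducible_of_monic hf.2.1 hy hf.1).symm

/-- A set of monic irreducible polynomials of degree `m` has `m` times as many roots as
elements. -/
theorem ncard_roots_of_subset_monicIrred [Finite F] [IsAlgClosed K] [Algebra.IsAlgebraic F K]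
    {m : ℕ} (hm : 0 < m) {S : Set F[X]} (hS : S ⊆ monicIrred F m) :
    {y : K | minpoly F y ∈ S}.Finite ∧ {y : K | minpoly F y ∈ S}.ncard = m * S.ncard := by
  classical
  have hfin : {y : K | minpoly F y ∈ S}.Finite := by
    have hX : (X ^ Nat.card F ^ m - X : K[X]) ≠ 0 :=
      FiniteField.X_pow_card_pow_sub_X_ne_zero K hm.ne' Finite.one_lt_card
    refine ((X ^ Nat.card F ^ m - X : K[X]).roots.toFinset.finite_toSet).subset ?_
    intro y hy
    have h1 := (iterate_frob_eq_self_iff (hS hy).2.1 (minpoly.aeval F y) m).2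
      (by rw [(hS hy).2.2])
    rw [iterate_frob_coe, OnePoint.coe_eq_coe] at h1
    simp [hX, h1]
  have hroot : ∀ f ∈ S, {y : K | minpoly F y = f}.ncard = m := by
    intro f hf
    have hirr := (hS hf).2.1
    have hsep : (f.map (algebraMap F K)).Separable :=
      (PerfectField.separable_of_irreducible hirr).map
    have hne : f.map (algebraMap F K) ≠ 0 :=
      (Polynomial.map_ne_zero_iff (algebraMap F K).injective).2 hirr.ne_zero
    rw [← (hS hf).2.2, ← natDegree_map (algebraMap F K), ← IsAlgClosed.card_roots_eq_natDegree,
      ← Multiset.toFinset_card_of_nodup (nodup_roots hsep), ← Set.ncard_coe_finset]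
    congr 1
    ext y
    simp [hne, minpoly_eq_iff_aeval_eq_zero (hS hf), eval_map_algebraMap]
  have himg : S = minpoly F '' {y : K | minpoly F y ∈ S} := by
    ext f
    constructor
    · intro hf
      have h1 := hroot f hf
      have h2 : {y : K | minpoly F y = f}.Nonempty := by
        apply Set.nonempty_of_ncard_ne_zero
        rw [h1]
        exact hm.ne'
      obtain ⟨y, rfl⟩ := h2
      exact ⟨y, hf, rfl⟩
    · rintro ⟨y, hy, rfl⟩
      exact hy
  have hSfin : S.Finite := himg ▸ hfin.image _
  refine ⟨hfin, ?_⟩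
  rw [ncard_eq_sum_ncard_fiber hfin (minpoly F) hSfin.toFinset fun y hy => by simpa using hy,
    Finset.sum_congr rfl (g := fun _ => m), Finset.sum_const, smul_eq_mul, mul_comm,
    Set.ncard_eq_toFinset_card S hSfin]
  intro f hf
  have hf' : f ∈ S := by simpa using hf
  rw [← hroot f hf']
  congr 1
  ext y
  simp only [Set.mem_ofPred_eq, and_iff_right_iff_imp]
  rintro rfl
  exact hf'

variable [DecidableEq K]

namespace IsPrimeQuotient

variable {G : Subgroup PGL(2, F)} {A : GL (Fin 2) F} {s : ℕ} {g h : F[X]}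

/-- The roots of the transform of `f` are the finite points above the roots of `f`. -/
theorem aeval_transform_eq_zero_iff (H : IsPrimeQuotient G A s g h) {f : F[X]} (hf : f ≠ 0)
    (x : K) : aeval x (transform g h f) = 0 ↔
      ∃ y : K, ratMap K g h (x : OnePoint K) = y ∧ aeval y f = 0 := by
  rw [transform_eq_homEval, map_homEval]
  by_cases hx : aeval x h = 0
  · have hgx : aeval x g ≠ 0 := H.aeval_num_ne_zero hx
    rw [hx, homEval_zero_right, (ratMap_coe_eq_infty_iff x).2 hx]
    constructor
    · intro h0
      have h1 : algebraMap F K (f.coeff f.natDegree) ≠ 0 :=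
        (map_ne_zero_iff _ (algebraMap F K).injective).2 (leadingCoeff_ne_zero.2 hf)
      exact absurd h0 (mul_ne_zero h1 (pow_ne_zero _ hgx))
    · rintro ⟨y, hy, -⟩
      exact absurd hy (OnePoint.infty_ne_coe y)
  · rw [homEval_eq_pow_mul_aeval le_rfl _ hx, ratMap_coe, if_neg hx, mul_eq_zero,
      or_iff_right (pow_ne_zero _ hx)]
    constructor
    · intro h0
      exact ⟨_, rfl, h0⟩
    · rintro ⟨y, hy, hy0⟩
      rw [OnePoint.coe_eq_coe] at hy
      rwa [hy]

theorem iterate_frob_ratMap [Finite F] (n : ℕ) (p : OnePoint K) :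
    (frob F K)^[n] (ratMap K g h p) = ratMap K g h ((frob F K)^[n] p) := by
  induction n with
  | zero => rfl
  | succ n ih => rw [iterate_succ_apply', iterate_succ_apply', ih, frob_ratMap]

theorem commute_frob_mob [Finite F] : Function.Commute (frob F K) (mob K A) :=
  fun p => frob_mob K A p

/-- Frobenius cannot move a fixed point of `A` inside its fibre. -/
theorem iterate_frob_eq_self_of_fixed [Finite F] [IsAlgClosed K] (H : IsPrimeQuotient G A s g h)
    {x y : K} (hfix : mob K A (x : OnePoint K) = x) (hxy : ratMap K g h (x : OnePoint K) = y)
    {n : ℕ} (hn : (frob F K)^[n] (y : OnePoint K) = y) :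
    (frob F K)^[n] (x : OnePoint K) = x := by
  have h1 : ratMap K g h ((frob F K)^[n] (x : OnePoint K)) = y := by
    rw [← iterate_frob_ratMap, hxy, hn]
  have h2 : mob K A ((frob F K)^[n] (x : OnePoint K)) = (frob F K)^[n] (x : OnePoint K) := by
    rw [← (commute_frob_mob.iterate_left n).eq, hfix]
  rw [iterate_frob_coe] at h1 h2 ⊢
  rw [H.eq_of_ratMap_eq_of_fixed h2 hfix h1 hxy]

/-- The transform of `f` is irreducible exactly when `Frob ^ deg f` moves the points above the
roots of `f`. -/
theorem transform_mem_monicIrred_iff [Finite F] [IsAlgClosed K] [Algebra.IsAlgebraic F K]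
    (H : IsPrimeQuotient G A s g h) {m : ℕ} {f : F[X]} (hf : f ∈ monicIrred F m) {x y : K}
    (hxy : ratMap K g h (x : OnePoint K) = y) (hy : aeval y f = 0) :
    transform g h f ∈ monicIrred F (s * m) ↔ (frob F K)^[m] (x : OnePoint K) ≠ x := by
  have hm : 0 < m := hf.2.2 ▸ hf.2.1.natDegree_pos
  have hx : aeval x (transform g h f) = 0 :=
    (H.aeval_transform_eq_zero_iff hf.2.1.ne_zero x).2 ⟨y, hxy, hy⟩
  obtain ⟨hTm, hTd⟩ := monic_transform H.monic (H.natDegree_num ▸ H.natDegree_denom_lt) hf.1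
  rw [H.natDegree_num, hf.2.2] at hTd
  constructor
  · intro hT h1
    have h2 := (iterate_frob_eq_self_iff hT.2.1 hx m).1 h1
    rw [hTd] at h2
    have h3 := Nat.le_of_dvd hm h2
    have h4 := H.prime.two_le
    nlinarith
  · intro hne
    have hym : (frob F K)^[m] (y : OnePoint K) = y :=
      (iterate_frob_eq_self_iff hf.2.1 hy m).2 (by rw [hf.2.2])
    have hmoved : mob K A (x : OnePoint K) ≠ x := fun hfix =>
      hne (H.iterate_frob_eq_self_of_fixed hfix hxy hym)
    obtain ⟨hrm, hri, -⟩ := minpoly_mem_monicIrred (F := F) x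
    set r := minpoly F x
    set t := r.natDegree with ht
    have hxt : (frob F K)^[t] (x : OnePoint K) = x :=
      (iterate_frob_eq_self_iff hri (minpoly.aeval F x) t).2 dvd_rfl
    have hyt : (frob F K)^[t] (y : OnePoint K) = y := by
      rw [← hxy, iterate_frob_ratMap, hxt]
    have hmt := (iterate_frob_eq_self_iff hf.2.1 hy t).1 hyt
    rw [hf.2.2] at hmt
    obtain ⟨k, hk⟩ := hmt
    obtain ⟨j, hj⟩ := H.exists_iterate_eq _ ((frob F K)^[m] (x : OnePoint K)) hmoved (by
      rw [← iterate_frob_ratMap, hxy, hym])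
    rw [hk, iterate_mul_eq_of_eq commute_frob_mob hj,
      iterate_eq_self_iff_dvd H.prime H.iterate_mob_card hmoved, H.prime.dvd_mul] at hxt
    rw [hj, Ne, iterate_eq_self_iff_dvd H.prime H.iterate_mob_card hmoved] at hne
    obtain ⟨l, rfl⟩ := hxt.resolve_left hne
    have hle : (transform g h f).natDegree ≤ r.natDegree := by
      have hl : 0 < l := by
        apply Nat.pos_of_ne_zero
        rintro rfl
        exact (hri.natDegree_pos).ne' (by rw [← ht, hk]; simp)
      rw [hTd, ← ht, hk, show m * (s * l) = s * m * l by ring]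
      exact Nat.le_mul_of_pos_right _ hl
    have heq : transform g h f = r :=
      (eq_of_monic_of_dvd_of_natDegree_le hrm hTm (minpoly.dvd F x hx) hle)
    refine ⟨hTm, ?_, hTd⟩
    rw [heq]
    exact hri

/-- Unramified counting: if no point above the roots of the polynomials in `S` is fixed by `A`, the
number of these points is `s * m * |S|`. -/
theorem ncard_points_above [Finite F] [IsAlgClosed K] [Algebra.IsAlgebraic F K]
    (H : IsPrimeQuotient G A s g h) {m : ℕ} (hm : 0 < m) {S : Set F[X]}
    (hS : S ⊆ monicIrred F m)
    (hmoved : ∀ (p : OnePoint K) (y : K), ratMap K g h p = y → minpoly F y ∈ S → mob K A p ≠ p) :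
    {p : OnePoint K | ∃ y : K, ratMap K g h p = y ∧ minpoly F y ∈ S}.ncard
      = s * (m * S.ncard) := by
  obtain ⟨hYfin, hYcard⟩ := ncard_roots_of_subset_monicIrred (K := K) hm hS
  set Y : Set K := {y : K | minpoly F y ∈ S}
  have hYfin' : (((↑) : K → OnePoint K) '' Y).Finite := hYfin.image _
  have hfin : {p : OnePoint K | ∃ y : K, ratMap K g h p = y ∧ minpoly F y ∈ S}.Finite := by
    refine (hYfin.biUnion (t := fun y : K => {p | ratMap K g h p = (y : OnePoint K)})
      fun y _ => (H.fiber_finite_ncard_le ((y : K) : OnePoint K)).1).subset ?_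
    rintro p ⟨y, hy, hyS⟩
    exact Set.mem_biUnion (show y ∈ Y from hyS) hy
  rw [ncard_eq_sum_ncard_fiber hfin (ratMap K g h) hYfin'.toFinset,
    Finset.sum_congr rfl (g := fun _ => s), Finset.sum_const, smul_eq_mul, mul_comm,
    ← Set.ncard_eq_toFinset_card _ hYfin',
    Set.ncard_image_of_injective _ OnePoint.coe_injective, hYcard]
  · intro p hp
    rw [Set.Finite.mem_toFinset] at hp
    obtain ⟨y, hy, rfl⟩ := hp
    obtain ⟨x, hx⟩ := H.exists_ratMap_eq y
    rw [← H.ncard_fiber (hmoved x y hx hy)]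
    congr 1
    ext p
    simp only [Set.mem_ofPred_eq, hx]
    exact ⟨fun hp => hp.2, fun hp => ⟨⟨y, hp, hy⟩, hp⟩⟩
  · rintro p ⟨y, hy, hyS⟩
    rw [Set.Finite.mem_toFinset, hy]
    exact ⟨y, hyS, rfl⟩

end IsPrimeQuotient

end

end RationalTransform

/-! ### Ramified points and exceptional degrees -/

namespace RationalTransform

open Polynomial OnePoint Function
open scoped MatrixGroups

noncomputable section

variable {F : Type*} [Field F] {K : Type*} [Field K] [Algebra F K] [DecidableEq K]

/-- A monic irreducible polynomial is fixed by `[B]` if one of its roots is. -/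
theorem mobiusAct_eq_self [IsAlgClosed K] {B : GL (Fin 2) F} {m : ℕ} {r : F[X]}
    (hr : r ∈ monicIrred F m) {x : K} (hx : aeval x r = 0)
    (hB : mob K B (x : OnePoint K) = x) : mobiusAct B r = r := by
  set p := homEval r.natDegree r (linNum B) (linDen B) with hp
  have haeval : ∀ z : K, aeval z p
      = homEval r.natDegree r (aeval z (linNum B)) (aeval z (linDen B)) :=
    fun z => map_homEval _ _ _ _ _
  have hvanish : ∀ z w : K, mob K B (z : OnePoint K) = w →
      ∃ v : K, v ≠ 0 ∧ aeval z p = v ^ r.natDegree * aeval w r := by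
    intro z w hzw
    rw [mob_coe] at hzw
    split_ifs at hzw with hv
    · exact absurd hzw (OnePoint.infty_ne_coe w)
    · rw [OnePoint.coe_eq_coe] at hzw
      exact ⟨_, hv, by rw [haeval, homEval_eq_pow_mul_aeval le_rfl _ hv, hzw]⟩
  -- `p = 0` would send all of `K` into the finite set of `∞` and the roots of `r`
  have hp0 : p ≠ 0 := by
    intro h0
    have hfin : (insert ∞ (((↑) : K → OnePoint K) ''
        (r.rootSet K))).Finite := ((rootSet_finite r K).image _).insert _
    have hinj : Injective fun z : K => mob K B (z : OnePoint K) :=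
      (mob_injective K B).comp OnePoint.coe_injective
    refine Set.infinite_univ ((hfin.preimage hinj.injOn).subset fun z _ => ?_)
    rw [Set.mem_preimage, Set.mem_insert_iff, or_iff_not_imp_left]
    intro hne
    obtain ⟨w, hw⟩ := OnePoint.ne_infty_iff_exists.1 hne
    refine ⟨w, ?_, hw⟩
    obtain ⟨v, hv, hvw⟩ := hvanish z w hw.symm
    rw [h0, map_zero] at hvw
    exact (mem_rootSet_of_ne hr.2.1.ne_zero).2
      ((mul_eq_zero.1 hvw.symm).resolve_left (pow_ne_zero _ hv))
  have hdvd : r ∣ p := by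
    obtain ⟨v, -, hv⟩ := hvanish x x hB
    rw [← hr.2.1.dvd_iff_aeval_eq_zero hx, hv, hx, mul_zero]
  have hdeg : p.natDegree ≤ r.natDegree := natDegree_homEval_le B _ _
  have hpr : p = C p.leadingCoeff * r := by
    obtain ⟨t, ht⟩ := hdvd
    have ht0 : t ≠ 0 := by
      rintro rfl
      exact hp0 (by rw [ht, mul_zero])
    rw [ht, natDegree_mul hr.2.1.ne_zero ht0] at hdeg
    have h1 : t = C (t.coeff 0) := eq_C_of_natDegree_eq_zero (by lia)
    have h2 : p.leadingCoeff = t.coeff 0 := by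
      rw [ht, leadingCoeff_mul, hr.1.leadingCoeff, one_mul, h1, leadingCoeff_C, coeff_C_zero]
    rw [h2, ← h1, ht, mul_comm]
  have hact : mobiusAct B r = C p.leadingCoeff⁻¹ * p := rfl
  have hlc : p.leadingCoeff ≠ 0 := leadingCoeff_ne_zero.2 hp0
  rw [hact]
  nth_rw 2 [hpr]
  rw [← mul_assoc, ← C_mul, inv_mul_cancel₀ hlc, C_1, one_mul]

namespace IsPrimeQuotient

variable {G : Subgroup PGL(2, F)} {A : GL (Fin 2) F} {s : ℕ} {g h : F[X]}

/-- Above a ramified `f`, i.e. one with a root `y` whose fibre contains a fixed point `x`, the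
transform of `f` is the power `r ^ k` of the minimal polynomial `r` of `x`, which is its own
`G`-orbit polynomial, and `k > 1`. -/
theorem transform_eq_orbitPoly_pow [Finite F] [IsAlgClosed K] [Algebra.IsAlgebraic F K]
    (H : IsPrimeQuotient G A s g h) {m : ℕ} {f : F[X]} (hf : f ∈ monicIrred F m) {x y : K}
    (hfix : mob K A (x : OnePoint K) = x) (hxy : ratMap K g h (x : OnePoint K) = y)
    (hy : aeval y f = 0) :
    ∃ r ∈ monicIrredNR G, ∃ k, 1 < k ∧ transform g h f = orbitPoly G r ^ k := by
  have hm : 0 < m := hf.2.2 ▸ hf.2.1.natDegree_pos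
  obtain ⟨hTm, hTd⟩ := monic_transform H.monic (H.natDegree_num ▸ H.natDegree_denom_lt) hf.1
  rw [H.natDegree_num, hf.2.2] at hTd
  have hr := minpoly_mem_monicIrred (F := F) x
  set r := minpoly F x with hrdef
  have hxr : aeval x r = 0 := minpoly.aeval F x
  have hxT : aeval x (transform g h f) = 0 :=
    (H.aeval_transform_eq_zero_iff hf.2.1.ne_zero x).2 ⟨y, hxy, hy⟩
  have hrT : r ∣ transform g h f := minpoly.dvd F x hxT
  have hfixB : ∀ B : GL (Fin 2) F, Matrix.ProjGenLinGroup.mk B ∈ G →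
      mob K B (x : OnePoint K) = x := by
    intro B hB
    obtain ⟨i, hi⟩ := H.exists_mob_eq_iterate (K := K) hB
    rw [hi]
    exact iterate_fixed hfix i
  have horbit : orbitPoly G r = r := by
    have h1 : polyOrbit G r = {r} := by
      ext t
      constructor
      · rintro ⟨B, hB, rfl⟩
        exact mobiusAct_eq_self hr hxr (hfixB B hB)
      · rintro rfl
        refine ⟨1, ?_, (mobiusAct_eq_self hr hxr (mob_one K _)).symm⟩
        rw [map_one]
        exact G.one_mem
    rw [orbitPoly, h1, finprod_mem_singleton]
  have hNR : r ∈ monicIrredNR G := by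
    refine ⟨hr.1, hr.2.1, ?_⟩
    rintro α ⟨B, hB, hc, rfl⟩ hα
    have h1 : aeval (algebraMap F K (B 0 0 / B 1 0)) (transform g h f) = 0 := by
      rw [aeval_algebraMap_apply, coe_aeval_eq_eval,
        eval_eq_zero_of_dvd_of_eval_eq_zero hrT hα, map_zero]
    obtain ⟨z, hz, -⟩ := (H.aeval_transform_eq_zero_iff hf.2.1.ne_zero _).1 h1
    have h2 : mob K B ∞ = ((algebraMap F K (B 0 0 / B 1 0) : K) : OnePoint K) := by
      rw [mob_infty, if_neg ((map_ne_zero_iff _ (algebraMap F K).injective).2 hc)]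
    rw [← h2, H.ratMap_mob hB, ratMap_infty] at hz
    exact OnePoint.infty_ne_coe z hz
  -- every root of the transform is conjugate to `x`
  have hconj : ∀ z : K, aeval z (transform g h f) = 0 → aeval z r = 0 := by
    intro z hz
    obtain ⟨y', hzy', hy'⟩ := (H.aeval_transform_eq_zero_iff hf.2.1.ne_zero z).1 hz
    have hyy' : IsConjRoot F y' y := by
      rw [IsConjRoot, (minpoly_eq_iff_aeval_eq_zero hf y).2 hy,
        (minpoly_eq_iff_aeval_eq_zero hf y').2 hy']
    have : Normal F K := normal_iff.2 fun w =>
      ⟨Algebra.IsIntegral.isIntegral w, IsAlgClosed.splits _⟩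
    obtain ⟨σ, rfl⟩ := hyy'.exists_algEquiv
    have h1 : mob K A ((σ x : K) : OnePoint K) = (σ x : K) := by
      rw [mob_coe_eq_self_iff] at hfix ⊢
      have := congrArg σ hfix
      simpa using this
    have h2 : ratMap K g h ((σ x : K) : OnePoint K) = (σ y : K) := by
      rw [H.ratMap_coe_eq_coe_iff] at hxy ⊢
      have := congrArg σ hxy
      rwa [map_mul, ← aeval_algHom_apply, ← aeval_algHom_apply] at this
    have h3 : mob K A (z : OnePoint K) = z := by
      by_contra hne
      exact H.mob_ne_self_of_ratMap_eq hne (h2.trans hzy'.symm) h1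
    rw [H.eq_of_ratMap_eq_of_fixed h3 h1 hzy' h2]
    rw [aeval_algHom_apply, hxr, map_zero]
  obtain ⟨w, hTw, hw⟩ := (FiniteMultiplicity.of_not_isUnit hr.2.1.not_isUnit
    hTm.ne_zero).exists_eq_pow_mul_and_not_dvd
  set k := multiplicity r (transform g h f)
  have hwm : w.Monic := (hr.1.pow k).of_mul_monic_left (hTw ▸ hTm)
  have hw1 : w = 1 := by
    by_contra hne
    have hwd : 0 < w.natDegree := hwm.natDegree_pos.2 hne
    obtain ⟨z, hz⟩ := IsAlgClosed.exists_aeval_eq_zero K w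
      (by rw [degree_eq_natDegree hwm.ne_zero]; exact_mod_cast hwd.ne')
    have hzr := hconj z (by rw [hTw, map_mul, hz, mul_zero])
    exact hw ((hr.2.1.dvd_iff_aeval_eq_zero hzr).1 hz)
  rw [hw1, mul_one] at hTw
  refine ⟨r, hNR, k, ?_, by rw [horbit, ← hTw]⟩
  -- degrees: `s * m = k * deg r` with `deg r ≤ m`
  have hrm : r.natDegree ∣ m := by
    rw [← iterate_frob_eq_self_iff hr.2.1 hxr]
    exact H.iterate_frob_eq_self_of_fixed hfix hxy
      ((iterate_frob_eq_self_iff hf.2.1 hy m).2 (by rw [hf.2.2]))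
  have hrm' := Nat.le_of_dvd hm hrm
  have h5 := congrArg natDegree hTw
  rw [hTd, natDegree_pow] at h5
  have h6 := H.prime.two_le
  by_contra! hk
  nlinarith

/-- If some transform is a proper power, then the degree occurs as the period of the image of one of
the finitely many fixed points of `A`. -/
theorem exists_fixed_of_transform_eq_pow [Finite F] [IsAlgClosed K] [Algebra.IsAlgebraic F K]
    (H : IsPrimeQuotient G A s g h) {m : ℕ} {f : F[X]} (hf : f ∈ monicIrred F m) {P : F[X]}
    {k : ℕ} (hk : 1 < k) (hT : transform g h f = P ^ k) :
    ∃ x : K, mob K A (x : OnePoint K) = x ∧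
      minimalPeriod (frob F K) (ratMap K g h (x : OnePoint K)) = m := by
  have hm : 0 < m := hf.2.2 ▸ hf.2.1.natDegree_pos
  obtain ⟨hTm, hTd⟩ := monic_transform H.monic (H.natDegree_num ▸ H.natDegree_denom_lt) hf.1
  rw [H.natDegree_num, hf.2.2, hT, natDegree_pow] at hTd
  have hs := H.prime.pos
  have hP0 : P ≠ 0 := by
    rintro rfl
    rw [natDegree_zero, mul_zero] at hTd
    exact (Nat.mul_pos hs hm).ne hTd
  by_contra! hno
  have hmoved : ∀ (p : OnePoint K) (y : K), ratMap K g h p = y →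
      minpoly F y ∈ ({f} : Set F[X]) → mob K A p ≠ p := by
    intro p y hp hy hfix
    induction p using OnePoint.rec with
    | infty => exact OnePoint.infty_ne_coe y hp
    | coe x =>
      refine hno x hfix ?_
      rw [hp, minimalPeriod_frob hf.2.1 ((minpoly_eq_iff_aeval_eq_zero hf y).1 hy), hf.2.2]
  have hcount := H.ncard_points_above hm (Set.singleton_subset_iff.2 hf) hmoved
  rw [Set.ncard_singleton, mul_one] at hcount
  have hsub : {p : OnePoint K | ∃ y : K, ratMap K g h p = y ∧ minpoly F y ∈ ({f} : Set F[X])}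
      ⊆ ((↑) : K → OnePoint K) '' (P.rootSet K) := by
    rintro p ⟨y, hp, hy⟩
    induction p using OnePoint.rec with
    | infty => exact absurd hp (OnePoint.infty_ne_coe y)
    | coe x =>
      refine ⟨x, ?_, rfl⟩
      have h1 := (H.aeval_transform_eq_zero_iff hf.2.1.ne_zero x).2
        ⟨y, hp, (minpoly_eq_iff_aeval_eq_zero hf y).1 hy⟩
      rw [hT, map_pow] at h1
      exact (mem_rootSet_of_ne hP0).2 (pow_eq_zero_iff (by lia) |>.1 h1)
  have h2 := Set.ncard_le_ncard hsub ((rootSet_finite P K).image _)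
  have h3 := ncard_rootSet_le P K
  rw [hcount, Set.ncard_image_of_injective _ OnePoint.coe_injective] at h2
  have h4 := Nat.mul_pos hs hm
  nlinarith

end IsPrimeQuotient

end

end RationalTransform

/-! ### Inert and split polynomials as inert and split points -/

namespace RationalTransform

open Polynomial OnePoint Function
open scoped MatrixGroups

noncomputable section

variable {F : Type*} [Field F]

theorem isPrimeQuotient_of_isQuotientMap {G : Subgroup PGL(2, F)} {s : ℕ} (hs : s.Prime)
    (hcard : Nat.card G = s) {Q : RatFunc F} (hQ : IsQuotientMap G Q) :
    ∃ A : GL (Fin 2) F, IsPrimeQuotient G A s (monicNum Q) (denomOfMonicNum Q) := by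
  have hne : G ≠ ⊥ := by
    rintro rfl
    rw [Subgroup.card_bot] at hcard
    exact hs.one_lt.ne hcard
  obtain ⟨γ, hγ, hγ1⟩ := G.bot_or_exists_ne_one.resolve_left hne
  obtain ⟨A, rfl⟩ := Matrix.ProjGenLinGroup.mk_surjective γ
  have h1 := hQ.isInvariantFraction (hcard ▸ hs.pos)
  rw [hcard] at h1
  exact ⟨A, ⟨h1, hs, hcard, hγ, hγ1⟩⟩

variable [Finite F]

namespace IsPrimeQuotient

variable {G : Subgroup PGL(2, F)} {A : GL (Fin 2) F} {s : ℕ} {Q : RatFunc F}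

theorem bddAbove_exceptionalDegrees
    (H : IsPrimeQuotient G A s (monicNum Q) (denomOfMonicNum Q)) :
    BddAbove (exceptionalDegrees G Q) := by
  classical
  let K := AlgebraicClosure F
  refine ((H.finite_fixed (K := K)).image fun x : K => minimalPeriod (frob F K)
    (ratMap K (monicNum Q) (denomOfMonicNum Q) (x : OnePoint K))).bddAbove.mono ?_
  rintro m ⟨f, hf, r, -, k, hk, hT⟩
  exact H.exists_fixed_of_transform_eq_pow hf hk hT

variable {K : Type*} [Field K] [Algebra F K] [DecidableEq K]

/-- The points above `∞` moved by `A` are rational. -/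
theorem iterate_frob_eq_self_of_ratMap_eq_infty
    (H : IsPrimeQuotient G A s (monicNum Q) (denomOfMonicNum Q)) {p : OnePoint K}
    (hp : mob K A p ≠ p) (hinf : ratMap K (monicNum Q) (denomOfMonicNum Q) p = ∞) (n : ℕ) :
    (frob F K)^[n] p = p := by
  obtain ⟨i, hi⟩ := H.exists_iterate_eq p ∞ hp (by rw [hinf, ratMap_infty])
  apply (mob_injective K A).iterate i
  rw [← (commute_frob_mob.iterate_iterate n i).eq, ← hi, iterate_frob_infty]

variable [IsAlgClosed K] [Algebra.IsAlgebraic F K]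

/-- The degree of a ramified polynomial is bounded by the exceptional bound. -/
theorem le_exceptionalBound (H : IsPrimeQuotient G A s (monicNum Q) (denomOfMonicNum Q))
    {x y : K} (hfix : mob K A (x : OnePoint K) = x)
    (hxy : ratMap K (monicNum Q) (denomOfMonicNum Q) (x : OnePoint K) = y) :
    (minpoly F y).natDegree ≤ exceptionalBound G Q := by
  apply le_csSup (H.bddAbove_exceptionalDegrees)
  have hf := minpoly_mem_monicIrred (F := F) y
  obtain ⟨r, hr, k, hk, hT⟩ := H.transform_eq_orbitPoly_pow hf hfix hxy (minpoly.aeval F y)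
  exact ⟨_, hf, r, hr, k, hk, hT⟩

theorem mem_setC_iff (H : IsPrimeQuotient G A s (monicNum Q) (denomOfMonicNum Q)) {m : ℕ}
    {x y : K} (hxy : ratMap K (monicNum Q) (denomOfMonicNum Q) (x : OnePoint K) = y)
    (hm : (minpoly F y).natDegree = m) :
    minpoly F y ∈ setC G Q m ↔ (frob F K)^[m] (x : OnePoint K) ≠ x := by
  have hf : minpoly F y ∈ monicIrred F m := hm ▸ minpoly_mem_monicIrred y
  rw [← H.transform_mem_monicIrred_iff hf hxy (minpoly.aeval F y), ← H.card_eq]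
  exact ⟨fun h => h.2, fun h => ⟨hf, h⟩⟩

theorem ncard_inertPoints_eq (H : IsPrimeQuotient G A s (monicNum Q) (denomOfMonicNum Q)) {m : ℕ}
    (hm : 0 < m) :
    (inertPoints (frob F K) (mob K A) (frob F K)
      (ratMap K (monicNum Q) (denomOfMonicNum Q)) m).ncard = s * (m * (setC G Q m).ncard) := by
  have hper : ∀ y : K, minimalPeriod (frob F K) (y : OnePoint K) = (minpoly F y).natDegree :=
    fun y => minimalPeriod_frob (minpoly_mem_monicIrred y).2.1 (minpoly.aeval F y)
  have hmoved : ∀ (p : OnePoint K) (y : K), ratMap K (monicNum Q) (denomOfMonicNum Q) p = y →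
      minpoly F y ∈ setC G Q m → mob K A p ≠ p := by
    intro p y hp hy hfix
    induction p using OnePoint.rec with
    | infty => exact OnePoint.infty_ne_coe y hp
    | coe x =>
      refine (H.mem_setC_iff hp hy.1.2.2).1 hy (H.iterate_frob_eq_self_of_fixed hfix hp ?_)
      rw [iterate_frob_eq_self_iff hy.1.2.1 (minpoly.aeval F y), hy.1.2.2]
  rw [← H.ncard_points_above hm (fun f hf => hf.1) hmoved]
  congr 1
  ext p
  constructor
  · rintro ⟨hp, hpm, hpf⟩
    by_cases hinf : ratMap K (monicNum Q) (denomOfMonicNum Q) p = ∞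
    · exact absurd (H.iterate_frob_eq_self_of_ratMap_eq_infty hp hinf m) hpf
    · obtain ⟨y, hy⟩ := OnePoint.ne_infty_iff_exists.1 hinf
      rw [← hy, hper] at hpm
      induction p using OnePoint.rec with
      | infty => exact absurd rfl hinf
      | coe x => exact ⟨y, hy.symm, (H.mem_setC_iff hy.symm hpm).2 hpf⟩
  · rintro ⟨y, hp, hy⟩
    refine ⟨hmoved p y hp hy, by rw [hp, hper, hy.1.2.2], ?_⟩
    induction p using OnePoint.rec with
    | infty => exact absurd hp (OnePoint.infty_ne_coe y)
    | coe x => exact (H.mem_setC_iff hp hy.1.2.2).1 hy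

/-- Beyond the exceptional bound there are no ramified polynomials, and no split points above `∞`:
the latter have period `1`, and they exist only if `A` moves `∞`, in which case `A` has a finite
fixed point and the exceptional bound is positive. -/
theorem ncard_splitPoints_eq (H : IsPrimeQuotient G A s (monicNum Q) (denomOfMonicNum Q)) {m : ℕ}
    (hm : exceptionalBound G Q < m) :
    (splitPoints (frob F K) (mob K A) (frob F K)
      (ratMap K (monicNum Q) (denomOfMonicNum Q)) m).ncard = s * (m * (setD G Q m).ncard) := by
  have hper : ∀ y : K, minimalPeriod (frob F K) (y : OnePoint K) = (minpoly F y).natDegree :=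
    fun y => minimalPeriod_frob (minpoly_mem_monicIrred y).2.1 (minpoly.aeval F y)
  have hmoved : ∀ (p : OnePoint K) (y : K), ratMap K (monicNum Q) (denomOfMonicNum Q) p = y →
      minpoly F y ∈ setD G Q m → mob K A p ≠ p := by
    intro p y hp hy hfix
    induction p using OnePoint.rec with
    | infty => exact OnePoint.infty_ne_coe y hp
    | coe x =>
      have := H.le_exceptionalBound hfix hp
      rw [hy.1.2.2] at this
      lia
  rw [← H.ncard_points_above (by lia) (fun f hf => hf.1) hmoved]
  congr 1
  ext p
  constructor
  · rintro ⟨hp, hpm, hpf⟩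
    by_cases hinf : ratMap K (monicNum Q) (denomOfMonicNum Q) p = ∞
    · exfalso
      have hm1 : m = 1 := by
        rw [← hpm, hinf]
        exact minimalPeriod_eq_one_iff_isFixedPt.2 rfl
      have hmov : mob K A ∞ ≠ ∞ := H.mob_ne_self_of_ratMap_eq hp (by rw [hinf, ratMap_infty])
      obtain ⟨x, hx⟩ := exists_fixed hmov
      have hxinf : ratMap K (monicNum Q) (denomOfMonicNum Q) (x : OnePoint K) ≠ ∞ := by
        intro hx'
        exact H.mob_ne_self_of_ratMap_eq hp (hx'.trans hinf.symm) hx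
      obtain ⟨y, hy⟩ := OnePoint.ne_infty_iff_exists.1 hxinf
      have h1 := H.le_exceptionalBound hx hy.symm
      have h2 := (minpoly_mem_monicIrred (F := F) y).2.1.natDegree_pos
      lia
    · obtain ⟨y, hy⟩ := OnePoint.ne_infty_iff_exists.1 hinf
      rw [← hy, hper] at hpm
      induction p using OnePoint.rec with
      | infty => exact absurd rfl hinf
      | coe x =>
        exact ⟨y, hy.symm, hpm ▸ minpoly_mem_monicIrred y,
          fun hC => (H.mem_setC_iff hy.symm hpm).1 hC hpf⟩
  · rintro ⟨y, hp, hy⟩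
    refine ⟨hmoved p y hp hy, by rw [hp, hper, hy.1.2.2], ?_⟩
    induction p using OnePoint.rec with
    | infty => exact absurd hp (OnePoint.infty_ne_coe y)
    | coe x =>
      by_contra hne
      exact hy.2 ((H.mem_setC_iff hp hy.1.2.2).2 hne)

end IsPrimeQuotient

end

end RationalTransform

open RationalTransform in
theorem theorem3 {F : Type*} [Field F] [Finite F]
    (G : Subgroup PGL(2, F)) (hG : IsCyclic G) (s : ℕ) (hs : s.Prime) (hcard : Nat.card G = s)
    (Q : RatFunc F) (hQ : RationalTransform.IsQuotientMap G Q)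
    (n : ℕ) (hn : RationalTransform.exceptionalBound G Q < n) :
    ((RationalTransform.setC G Q n).ncard : ℤ)
        - ((s : ℤ) - 1) * ((RationalTransform.setD G Q n).ncard : ℤ)
      = if s ∣ n then ((RationalTransform.setC G Q (n / s)).ncard : ℤ) else 0 := by
  classical
  obtain ⟨A, H⟩ := isPrimeQuotient_of_isQuotientMap hs hcard hQ
  let K := AlgebraicClosure F
  have hn0 : 0 < n := by lia
  have hcount : ∀ n, 0 < n → ∀ i, {p : OnePoint K | (frob F K)^[n] p = (mob K A)^[i] p}.ncard
      = Nat.card F ^ n + 1 := by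
    intro n hn i
    rw [iterate_mob]
    exact ncard_iterate_frob_eq_mob K (A ^ i) hn
  have key := ncard_inertPoints hs (IsPrimeQuotient.commute_frob_mob (K := K) (A := A))
    H.iterate_mob_card (fun p => (frob_ratMap K _ _ p).symm)
    (H.ratMap_mob H.mem) H.exists_iterate_eq (fun n => Nat.card F ^ n + 1)
    (fun n hn i => Set.finite_of_ncard_ne_zero (by rw [hcount n hn i]; exact Nat.succ_ne_zero _))
    hcount n hn0
  rw [H.ncard_inertPoints_eq hn0, H.ncard_splitPoints_eq hn] at key
  have hsn : (s : ℤ) * n ≠ 0 := by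
    have h1 := hs.pos
    positivity
  apply mul_left_cancel₀ hsn
  split_ifs at key ⊢ with hdvd
  · obtain ⟨k, rfl⟩ := hdvd
    have hk : 0 < k := Nat.pos_of_ne_zero (by rintro rfl; simp at hn0)
    rw [Nat.mul_div_cancel_left k hs.pos] at key ⊢
    rw [H.ncard_inertPoints_eq hk] at key
    push_cast at key ⊢
    linear_combination key
  · push_cast at key
    linear_combination key
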